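/- Let $r,d,k\ge 1$ and $e\ge 0$ be integers with $k\mid r$, $k\mid d$ and $e<d$. **Dowling lattices.** Let $G$ be a finite group. A $G$-prepartition of $[n]=\{1,\dots,n\}$ is a triple $(I,\pi,\gamma)$ with $I\subseteq[n]$ (the zero block), $\pi$ a partition of $[n]\setminus I$ into nonempty (nonzero) blocks, and $\gamma:[n]\setminus I\to G$. Two prepartitions are equivalent if they have the same zero block and the same nonzero blocks, and on each nonzero block $B$ the labellings differ by right multiplication by an element $g_B\in G$. The Dowling lattice $Q_n(G)$ is the set of equivalence classes, ordered by the relation generated by merging a nonzero block into the zero block, or merging two nonzero blocks $(B,\gamma_B)$, $(C,\gamma_C)$ into $(B,\gamma_B)\cup(C,\gamma_C)\cdot g$ for some $g\in G$. Write $Q_n(r)=Q_n(\mu_r)$, where $\mu_r$ is the cyclic group identified with $\mathbb Z/r\mathbb Z$. Let $Q_N(r,d,k)$ be the subposet of all elements of $Q_N(r)$ such that for every nonzero block $B$ the size $|B|$ is divisible by $d$ and $|\{a\in B:\gamma(a)\equiv j \pmod k\}|$ is independent of $j$, together with an adjoined minimum element $\hat 0$ (adjoined as a new element also when $d=1$ or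 $N=0$). **The posets.** For $n\ge 0$ let $S_n^{(d,e,k)}=Q_{dn+e}(r,d,k)\setminus\{\hat 0\}$. For $n\ge1$ let $c_n\in Q_{dn}(r,d,k)$ be the element with empty zero block, a single nonzero block $\{1,\dots,dn\}$, and labels $\gamma(i)=\lfloor (i-1)k/(dn)\rfloor+1$; let $R_n'^{(d,k)}=\{x\in Q_{dn}(r,d,k): \hat 0\neq x\le c_n\}$. **Exponential structures.** Let the rank $\operatorname{rk}(x)$ of an element $x$ be the largest length of a chain ending in $x$, so that minimal elements have rank $0$. A sequence of posets $(R_1,R_2,\dots)$ is an exponential structure if for all $n\ge1$: (E1) $R_n$ has a unique maximal element $\hat 1$, which is a greatest element, and every maximal chain of $R_n$ has $n$ elements; (E2) for $x\in R_n$ of rank $m$ the interval $[x,\hat 1]$ is isomorphic to the lattice $\Pi_{n-m}$ of partitions of an $(n-m)$-element set; (E3) every $x\in R_n$ has a type $(a_1,\dots,a_n)$ with $\sum_i i\,a_i=n$ such that the lower order ideal generated by $x$ is isomorphic to $R_1^{a_1}\times\cdots\times R_n^{a_n}$; (E4) $R_n$ has a finite number $M(n)$ of minimal elements. For a finite group $G$,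 a sequence of posets $(S_0,S_1,\dots)$ is an exponential Dowling structure for $G$ associated with an exponential structure $(R_1,R_2,\dots)$ if for all $n\ge0$: (D1) $S_n$ has a unique maximal element $\hat 1$, which is a greatest element, and every maximal chain of $S_n$ has $n+1$ elements; (D2) for $x\in S_n$ the interval $[x,\hat 1]$ is isomorphic to $Q_{n-\operatorname{rk}(x)}(G)$; (D3) every $x\in S_n$ has a type $(b;a_1,\dots,a_n)$ with $b+\sum_i i\,a_i=n$ such that the lower order ideal generated by $x$ is isomorphic to $S_b\times R_1^{a_1}\times\cdots\times R_n^{a_n}$; (D4) $S_n$ has a finite number $N(n)$ of minimal elements. **Claim.** The sequence $(R_1'^{(d,k)},R_2'^{(d,k)},\dots)$ is an exponential structure, and the sequence $(S_0^{(d,e,k)},S_1^{(d,e,k)},\dots)$ is an exponential Dowling structure for the group $\mu_r$ associated with it. -/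

import Mathlib

/-- A `G`-prepartition `(I, π, γ)` of `{1, …, n}` (modelled by `Fin n`): the zero block `I`, a
partition `π` of the complement of `I`, and a labelling `γ` by elements of `G`.  Only the labels of
the elements outside `I` matter: the values of `γ` on `I` are ignored by everything below. -/
structure GPrepartition (G : Type*) (n : ℕ) where
  zero : Finset (Fin n)
  π : Finpartition zeroᶜ
  γ : Fin n → G

namespace GPrepartition

variable {G : Type*} [Group G] {n : ℕ}

/-- The labellings `γ` and `γ'` of the set `B` define the same `G`-block: the subset
`{(i, γ' i) | i ∈ B}` of `[n] × G` is a right translate of `{(i, γ i) | i ∈ B}`. -/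
def SameLabels (B : Finset (Fin n)) (γ γ' : Fin n → G) : Prop :=
  ∃ g : G, ∀ i ∈ B, γ' i = γ i * g

lemma SameLabels.refl (B : Finset (Fin n)) (γ : Fin n → G) : SameLabels B γ γ :=
  ⟨1, fun i _ => by simp⟩

lemma SameLabels.symm {B : Finset (Fin n)} {γ γ' : Fin n → G} (h : SameLabels B γ γ') :
    SameLabels B γ' γ := by
  obtain ⟨g, hg⟩ := h
  exact ⟨g⁻¹, fun i hi => by simp [hg i hi]⟩

lemma SameLabels.trans {B C : Finset (Fin n)} {γ γ' γ'' : Fin n → G}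
    (h : SameLabels B γ γ') (hBC : B ⊆ C) (h' : SameLabels C γ' γ'') : SameLabels B γ γ'' := by
  obtain ⟨g, hg⟩ := h
  obtain ⟨g', hg'⟩ := h'
  exact ⟨g * g', fun i hi => by rw [hg' i (hBC hi), hg i hi, mul_assoc]⟩

/-- Two prepartitions are equivalent if they have the same zero block and the same nonzero blocks
up to the right action of `G` on each block separately. -/
def Equivalent (p q : GPrepartition G n) : Prop :=
  p.zero = q.zero ∧ p.π.parts = q.π.parts ∧ ∀ B ∈ p.π.parts, SameLabels B p.γ q.γ

/-- The Dowling order on representatives: the zero block of `p` is contained in that of `q`, and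
each nonzero `G`-block of `p` is either swallowed by the zero block of `q` or is, as a labelled
block up to the action of `G`, contained in a nonzero `G`-block of `q`. -/
def Refines (p q : GPrepartition G n) : Prop :=
  p.zero ⊆ q.zero ∧ ∀ B ∈ p.π.parts,
    B ⊆ q.zero ∨ ((∃ C ∈ q.π.parts, B ⊆ C) ∧ SameLabels B p.γ q.γ)

/-- `q` arises from `p` by merging the zero block with a nonzero `G`-block, or by merging two
nonzero `G`-blocks `B`, `C` into `(B, γ) ∪ (C, γ) · g` for some `g` in `G` (all of this up to the
choice of representatives of the `G`-blocks). -/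
def Merge (p q : GPrepartition G n) : Prop :=
  (∃ B ∈ p.π.parts, q.zero = p.zero ∪ B ∧ q.π.parts = p.π.parts.erase B ∧
      ∀ D ∈ p.π.parts.erase B, SameLabels D p.γ q.γ) ∨
  (∃ B ∈ p.π.parts, ∃ C ∈ p.π.parts, B ≠ C ∧ q.zero = p.zero ∧
      q.π.parts = insert (B ∪ C) ((p.π.parts.erase B).erase C) ∧
      (∀ D ∈ (p.π.parts.erase B).erase C, SameLabels D p.γ q.γ) ∧
      ∃ g : G, SameLabels (B ∪ C) (fun i => if i ∈ C then p.γ i * g else p.γ i) q.γ)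

lemma Refines.refl (p : GPrepartition G n) : Refines p p :=
  ⟨subset_rfl, fun B hB => Or.inr ⟨⟨B, hB, subset_rfl⟩, SameLabels.refl _ _⟩⟩

lemma Refines.trans {p q s : GPrepartition G n} (h : Refines p q) (h' : Refines q s) :
    Refines p s := by
  refine ⟨h.1.trans h'.1, fun B hB => ?_⟩
  rcases h.2 B hB with h1 | ⟨⟨C, hC, hBC⟩, h2⟩
  · exact Or.inl (h1.trans h'.1)
  · rcases h'.2 C hC with h3 | ⟨⟨D, hD, hCD⟩, h4⟩
    · exact Or.inl (hBC.trans h3)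
    · exact Or.inr ⟨⟨D, hD, hBC.trans hCD⟩, h2.trans hBC h4⟩

lemma Equivalent.refines {p q : GPrepartition G n} (h : Equivalent p q) : Refines p q :=
  ⟨h.1.subset, fun B hB => Or.inr ⟨⟨B, h.2.1 ▸ hB, subset_rfl⟩, h.2.2 B hB⟩⟩

lemma Equivalent.symm {p q : GPrepartition G n} (h : Equivalent p q) : Equivalent q p :=
  ⟨h.1.symm, h.2.1.symm, fun B hB => (h.2.2 B (h.2.1 ▸ hB)).symm⟩

set_option linter.unusedSectionVars false in
lemma part_not_subset_zero (p : GPrepartition G n) {B : Finset (Fin n)} (hB : B ∈ p.π.parts) :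
    ¬ B ⊆ p.zero := by
  obtain ⟨i, hi⟩ := p.π.nonempty_of_mem_parts hB
  intro h
  exact Finset.mem_compl.1 (p.π.le hB hi) (h hi)

lemma parts_subset_of_refines {p q : GPrepartition G n} (h : Refines p q) (h' : Refines q p) :
    p.π.parts ⊆ q.π.parts := by
  have hz : p.zero = q.zero := subset_antisymm h.1 h'.1
  intro B hB
  rcases h.2 B hB with h1 | ⟨⟨C, hC, hBC⟩, -⟩
  · exact absurd (hz ▸ h1) (p.part_not_subset_zero hB)
  rcases h'.2 C hC with h1 | ⟨⟨D, hD, hCD⟩, -⟩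
  · exact absurd (hz ▸ h1) (q.part_not_subset_zero hC)
  obtain ⟨i, hi⟩ := p.π.nonempty_of_mem_parts hB
  have : B = D := p.π.disjoint.elim_finset hB hD i hi (hCD (hBC hi))
  subst this
  rwa [subset_antisymm hBC hCD]

lemma Refines.antisymm {p q : GPrepartition G n} (h : Refines p q) (h' : Refines q p) :
    Equivalent p q := by
  refine ⟨subset_antisymm h.1 h'.1, subset_antisymm (parts_subset_of_refines h h')
    (parts_subset_of_refines h' h), fun B hB => ?_⟩
  rcases h.2 B hB with h1 | ⟨-, h2⟩
  · exact absurd (h1.trans h'.1) (p.part_not_subset_zero hB)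
  · exact h2

instance setoid (G : Type*) [Group G] (n : ℕ) : Setoid (GPrepartition G n) where
  r := Equivalent
  iseqv :=
    { refl := fun p => (Refines.refl p).antisymm (Refines.refl p)
      symm := Equivalent.symm
      trans := fun h h' => (h.refines.trans h'.refines).antisymm
        (h'.symm.refines.trans h.symm.refines) }

lemma Merge.refines {p q : GPrepartition G n} (h : Merge p q) : Refines p q := by
  rcases h with ⟨B, hB, hz, hp, hl⟩ | ⟨B, hB, C, hC, hBC, hz, hp, hl, g, u, hu⟩
  · refine ⟨by rw [hz]; exact Finset.subset_union_left, fun D hD => ?_⟩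
    by_cases hDB : D = B
    · left; rw [hz, hDB]; exact Finset.subset_union_right
    · have hD' : D ∈ p.π.parts.erase B := Finset.mem_erase.2 ⟨hDB, hD⟩
      exact Or.inr ⟨⟨D, by rw [hp]; exact hD', subset_rfl⟩, hl D hD'⟩
  · refine ⟨hz.symm.subset, fun D hD => Or.inr ?_⟩
    have hmem : B ∪ C ∈ q.π.parts := by rw [hp]; exact Finset.mem_insert_self _ _
    have hdisj : ∀ i ∈ B, i ∉ C := fun i hi hi' => hBC (p.π.disjoint.elim_finset hB hC i hi hi')
    by_cases hDB : D = B
    · subst hDB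
      refine ⟨⟨_, hmem, Finset.subset_union_left⟩, u, fun i hi => ?_⟩
      simpa [hdisj i hi] using hu i (Finset.mem_union_left _ hi)
    by_cases hDC : D = C
    · subst hDC
      refine ⟨⟨_, hmem, Finset.subset_union_right⟩, g * u, fun i hi => ?_⟩
      simpa [hi, mul_assoc] using hu i (Finset.mem_union_right _ hi)
    have hD' : D ∈ (p.π.parts.erase B).erase C :=
      Finset.mem_erase.2 ⟨hDC, Finset.mem_erase.2 ⟨hDB, hD⟩⟩
    exact ⟨⟨D, by rw [hp]; exact Finset.mem_insert_of_mem hD', subset_rfl⟩, hl D hD'⟩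

end GPrepartition

/-- The underlying set of the Dowling lattice `Q_n(G)`: the `G`-partitions, i.e. equivalence
classes of `G`-prepartitions. -/
def DowlingLattice (G : Type*) [Group G] (n : ℕ) : Type _ :=
  Quotient (GPrepartition.setoid G n)

namespace DowlingLattice

variable {G : Type*} [Group G] {n : ℕ}

/-- The `G`-partition represented by a `G`-prepartition. -/
def mk (p : GPrepartition G n) : DowlingLattice G n := Quotient.mk _ p

lemma mk_eq_mk {p q : GPrepartition G n} : mk p = mk q ↔ p.Equivalent q := Quotient.eq

instance : PartialOrder (DowlingLattice G n) where
  le x y := Quotient.liftOn₂ x y GPrepartition.Refines (fun _ _ _ _ h h' => propext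
    ⟨fun H => (h.symm.refines.trans H).trans h'.refines,
      fun H => (h.refines.trans H).trans h'.symm.refines⟩)
  le_refl x := Quotient.inductionOn x GPrepartition.Refines.refl
  le_trans x y z := Quotient.inductionOn₃ x y z (fun _ _ _ h h' => h.trans h')
  le_antisymm x y := Quotient.inductionOn₂ x y (fun _ _ h h' => Quotient.sound (h.antisymm h'))

lemma mk_le_mk {p q : GPrepartition G n} : mk p ≤ mk q ↔ p.Refines q := Iff.rfl

lemma exists_merge {p q : GPrepartition G n} (h : p.Refines q) (hne : ¬ q.Refines p) :
    ∃ s : GPrepartition G n, p.Merge s ∧ s.Refines q ∧ s.π.parts.card < p.π.parts.card := by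
  classical
  by_cases h0 : ∃ B ∈ p.π.parts, B ⊆ q.zero
  · obtain ⟨B, hB, hBq⟩ := h0
    refine ⟨⟨p.zero ∪ B, p.π.ofSubset (Finset.erase_subset B _) ?_, p.γ⟩,
      Or.inl ⟨B, hB, rfl, rfl, fun D _ => .refl _ _⟩,
      ⟨Finset.union_subset h.1 hBq, fun D hD => h.2 D (Finset.mem_of_mem_erase hD)⟩,
      Finset.card_erase_lt_of_mem hB⟩
    ext i
    simp only [Finset.mem_sup, id, Finset.mem_erase, Finset.mem_compl, Finset.mem_union, not_or]
    constructor
    · rintro ⟨D, ⟨hDB, hD⟩, hi⟩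
      exact ⟨Finset.mem_compl.1 (p.π.le hD hi), fun hi' => hDB (p.π.eq_of_mem_parts hD hB hi hi')⟩
    · rintro ⟨hi, hiB⟩
      obtain ⟨D, hD, hiD⟩ := p.π.exists_mem (Finset.mem_compl.2 hi)
      exact ⟨D, ⟨fun h => hiB (h ▸ hiD), hD⟩, hiD⟩
  have hin : ∀ B ∈ p.π.parts, (∃ C ∈ q.π.parts, B ⊆ C) ∧
      GPrepartition.SameLabels B p.γ q.γ :=
    fun B hB => (h.2 B hB).resolve_left fun h1 => h0 ⟨B, hB, h1⟩
  have hz : q.zero = p.zero := by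
    refine subset_antisymm (fun i hi => ?_) h.1
    by_contra hip
    obtain ⟨B, hB, hiB⟩ := p.π.exists_mem (Finset.mem_compl.2 hip)
    obtain ⟨⟨C, hC, hBC⟩, -⟩ := hin B hB
    exact Finset.mem_compl.1 (q.π.le hC (hBC hiB)) hi
  by_cases h1 : ∃ B ∈ p.π.parts, ∃ C ∈ p.π.parts, B ≠ C ∧ ∃ D ∈ q.π.parts, B ⊆ D ∧ C ⊆ D
  · obtain ⟨B, hB, C, hC, hBC, D, hD, hBD, hCD⟩ := h1
    obtain ⟨-, u, hu⟩ := hin B hB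
    obtain ⟨-, v, hv⟩ := hin C hC
    have hdisj : ∀ i ∈ B, i ∉ C := fun i hi hi' => hBC (p.π.eq_of_mem_parts hB hC hi hi')
    let parts := insert (B ∪ C) ((p.π.parts.erase B).erase C)
    have hparts : ∀ E, E ∈ parts ↔ E = B ∪ C ∨ (E ≠ C ∧ E ≠ B ∧ E ∈ p.π.parts) := by
      intro E; simp [parts]
    let P : Finpartition p.zeroᶜ := Finpartition.ofExistsUnique parts
      (by
        intro E hE
        rcases (hparts E).1 hE with rfl | ⟨-, -, hE⟩
        · exact Finset.union_subset (p.π.le hB) (p.π.le hC)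
        · exact p.π.le hE)
      (by
        intro i hi
        obtain ⟨E, hE, hiE⟩ := p.π.exists_mem hi
        have huniq : ∀ F ∈ p.π.parts, i ∈ F → F = E :=
          fun F hF hiF => p.π.eq_of_mem_parts hF hE hiF hiE
        by_cases hEBC : i ∈ B ∪ C
        · refine ⟨B ∪ C, ⟨(hparts _).2 (Or.inl rfl), hEBC⟩, fun F hF => ?_⟩
          rcases (hparts F).1 hF.1 with hF' | ⟨hFC, hFB, hF'⟩
          · exact hF'
          · rcases Finset.mem_union.1 hEBC with hi' | hi'
            · exact absurd (p.π.eq_of_mem_parts hF' hB hF.2 hi') hFB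
            · exact absurd (p.π.eq_of_mem_parts hF' hC hF.2 hi') hFC
        · refine ⟨E, ⟨(hparts _).2 (Or.inr ⟨?_, ?_, hE⟩), hiE⟩, fun F hF => ?_⟩
          · rintro rfl; exact hEBC (Finset.mem_union_right _ hiE)
          · rintro rfl; exact hEBC (Finset.mem_union_left _ hiE)
          · rcases (hparts F).1 hF.1 with hF' | ⟨hFC, hFB, hF'⟩
            · exact absurd (hF' ▸ hF.2) hEBC
            · exact huniq F hF' hF.2)
      (by
        intro hE
        rcases (hparts ∅).1 hE with hE' | ⟨-, -, hE⟩
        · obtain ⟨i, hi⟩ := p.π.nonempty_of_mem_parts hB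
          have : i ∈ B ∪ C := Finset.mem_union_left _ hi
          rw [← hE'] at this
          simp at this
        · simpa using p.π.nonempty_of_mem_parts hE)
    have hP : P.parts = parts := rfl
    refine ⟨⟨p.zero, P, fun i => if i ∈ C then p.γ i * (v * u⁻¹) else p.γ i⟩,
      Or.inr ⟨B, hB, C, hC, hBC, rfl, rfl, fun E hE => ⟨1, fun i hi => ?_⟩, v * u⁻¹, .refl _ _⟩,
      ⟨hz.symm.subset, fun E hE => Or.inr ?_⟩, ?_⟩
    · have hEC : E ≠ C ∧ E ≠ B ∧ E ∈ p.π.parts := by simpa using hE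
      have : i ∉ C := fun hi' => hEC.1 (p.π.eq_of_mem_parts hEC.2.2 hC hi hi')
      simp [this]
    · rcases (hparts E).1 hE with rfl | ⟨hEC, hEB, hE'⟩
      · refine ⟨⟨D, hD, Finset.union_subset hBD hCD⟩, u, fun i hi => ?_⟩
        by_cases hiC : i ∈ C
        · simp [hiC, hv i hiC, mul_assoc]
        · have hiB : i ∈ B := (Finset.mem_union.1 hi).resolve_right hiC
          simp [hiC, hu i hiB]
      · obtain ⟨hF, w, hw⟩ := hin E hE'
        refine ⟨hF, w, fun i hi => ?_⟩
        have : i ∉ C := fun hi' => hEC (p.π.eq_of_mem_parts hE' hC hi hi')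
        simp [this, hw i hi]
    · change parts.card < _
      have h2 : C ∈ p.π.parts.erase B := Finset.mem_erase.2 ⟨hBC.symm, hC⟩
      have := Finset.card_insert_le (B ∪ C) ((p.π.parts.erase B).erase C)
      have := Finset.card_erase_lt_of_mem h2
      have := Finset.card_erase_lt_of_mem hB
      change (insert (B ∪ C) ((p.π.parts.erase B).erase C)).card < _
      omega
  · exfalso
    apply hne
    refine ⟨hz.subset, fun D hD => Or.inr ?_⟩
    obtain ⟨i, hi⟩ := q.π.nonempty_of_mem_parts hD
    have key : ∀ j ∈ D, ∃ B ∈ p.π.parts, j ∈ B ∧ B ⊆ D := by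
      intro j hj
      have : j ∈ p.zeroᶜ := by rw [← hz]; exact q.π.le hD hj
      obtain ⟨B, hB, hjB⟩ := p.π.exists_mem this
      obtain ⟨⟨C, hC, hBC⟩, -⟩ := hin B hB
      exact ⟨B, hB, hjB, (q.π.eq_of_mem_parts hC hD (hBC hjB) hj) ▸ hBC⟩
    obtain ⟨B, hB, hiB, hBD⟩ := key i hi
    have hDB : D ⊆ B := by
      intro j hj
      obtain ⟨C, hC, hjC, hCD⟩ := key j hj
      by_contra hjB
      exact h1 ⟨B, hB, C, hC, fun h => hjB (h ▸ hjC), D, hD, hBD, hCD⟩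
    obtain ⟨u, hu⟩ := (hin B hB).2
    exact ⟨⟨B, hB, hDB⟩, GPrepartition.SameLabels.symm ⟨u, fun j hj => hu j (hDB hj)⟩⟩

/-- The order is the one generated by merging two `G`-blocks. -/
theorem le_iff_merges (x y : DowlingLattice G n) :
    x ≤ y ↔ Relation.ReflTransGen
      (fun x y : DowlingLattice G n => ∃ p q, x = mk p ∧ y = mk q ∧ p.Merge q) x y := by
  constructor
  · induction x using Quotient.inductionOn with | _ p => ?_
    induction y using Quotient.inductionOn with | _ q => ?_
    change mk p ≤ mk q → Relation.ReflTransGen _ (mk p) (mk q)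
    induction hc : p.π.parts.card using Nat.strong_induction_on generalizing p with | _ c ih => ?_
    intro h
    by_cases hne : q.Refines p
    · have : mk p = mk q := le_antisymm h hne
      rw [this]
    · obtain ⟨s, hps, hsq, hcard⟩ := exists_merge (mk_le_mk.1 h) hne
      exact .head ⟨p, s, rfl, rfl, hps⟩ (ih _ (hc ▸ hcard) s rfl hsq)
  · intro h
    induction h with
    | refl => exact le_rfl
    | tail _ h ih =>
      obtain ⟨p, q, rfl, rfl, hm⟩ := h
      exact ih.trans hm.refines

end DowlingLattice

/-- The cyclic group `μ_r`, identified with `ℤ/rℤ`, written multiplicatively. -/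
abbrev CyclicGroup (r : ℕ) : Type := Multiplicative (ZMod r)

/-- Every nonzero block has size divisible by `d` and contains, for each residue class `j` modulo
`k`, the same number of elements with label congruent to `j` modulo `k`. -/
def GPrepartition.IsEvenlyColoured {r n : ℕ} (d k : ℕ) (p : GPrepartition (CyclicGroup r) n) :
    Prop :=
  ∀ B ∈ p.π.parts, d ∣ B.card ∧ ∀ j j' : ZMod k,
    (B.filter fun a => ((p.γ a).toAdd.cast : ZMod k) = j).card =
      (B.filter fun a => ((p.γ a).toAdd.cast : ZMod k) = j').card

/-- The `d`-divisible, `k`-evenly coloured `G`-partitions in `Q_N(r)`. -/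
def evenlyColoured (N r d k : ℕ) : Set (DowlingLattice (CyclicGroup r) N) :=
  {x | ∃ p, x = DowlingLattice.mk p ∧ p.IsEvenlyColoured d k}

lemma GPrepartition.IsEvenlyColoured.congr {r n d k : ℕ} (hkr : k ∣ r)
    {p q : GPrepartition (CyclicGroup r) n} (h : p.Equivalent q) (hp : p.IsEvenlyColoured d k) :
    q.IsEvenlyColoured d k := by
  intro B hB
  have hB' : B ∈ p.π.parts := h.2.1 ▸ hB
  obtain ⟨g, hg⟩ := h.2.2 B hB'
  obtain ⟨h1, h2⟩ := hp B hB'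
  have key : ∀ j : ZMod k, (B.filter fun a => ((q.γ a).toAdd.cast : ZMod k) = j) =
      B.filter fun a => ((p.γ a).toAdd.cast : ZMod k) = j - (g.toAdd.cast : ZMod k) := by
    intro j
    refine Finset.filter_congr fun a ha => ?_
    rw [hg a ha, toAdd_mul, ZMod.cast_add hkr, eq_sub_iff_add_eq]
  exact ⟨h1, fun j j' => by rw [key, key]; exact h2 _ _⟩

/-- Membership in `evenlyColoured` does not depend on the representative. -/
lemma mk_mem_evenlyColoured {N r d k : ℕ} (hkr : k ∣ r) (p : GPrepartition (CyclicGroup r) N) :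
    DowlingLattice.mk p ∈ evenlyColoured N r d k ↔ p.IsEvenlyColoured d k := by
  constructor
  · rintro ⟨q, hq, h⟩
    exact h.congr hkr (DowlingLattice.mk_eq_mk.1 hq).symm
  · exact fun h => ⟨p, rfl, h⟩

/-- For `d ≥ 2` and `N ≥ 1` the minimum of `Q_N(r)` is not `d`-divisible, so that adding it to the
evenly coloured elements amounts to adjoining a new minimum. -/
lemma not_isBot_of_mem_evenlyColoured {N r d k : ℕ} (hd : 2 ≤ d) (hN : 1 ≤ N)
    {x : DowlingLattice (CyclicGroup r) N} (hx : x ∈ evenlyColoured N r d k) : ¬ IsBot x := by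
  obtain ⟨p, rfl, hp⟩ := hx
  intro hbot
  have h : p.Refines ⟨∅, ⊥, 1⟩ := hbot (DowlingLattice.mk ⟨∅, ⊥, 1⟩)
  have hi : (⟨0, hN⟩ : Fin N) ∈ p.zeroᶜ :=
    Finset.mem_compl.2 fun hi => absurd (h.1 hi) (Finset.notMem_empty _)
  obtain ⟨B, hB, hiB⟩ := p.π.exists_mem hi
  rcases h.2 B hB with h1 | ⟨⟨C, hC, hBC⟩, -⟩
  · exact absurd (h1 hiB) (Finset.notMem_empty _)
  · obtain ⟨j, -, rfl⟩ := Finpartition.mem_bot_iff.1 hC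
    have h1 : B.card ≤ 1 := by simpa using Finset.card_le_card hBC
    have h2 : 0 < B.card := Finset.card_pos.2 ⟨_, hiB⟩
    have h3 := Nat.le_of_dvd h2 (hp B hB).1
    omega

/-- The poset `Q_N(r, d, k)`: the `d`-divisible, `k`-evenly coloured elements of `Q_N(r)` together
with an adjoined minimum `⊥` (adjoined also in the degenerate cases `d = 1` and `N = 0`, in which
the minimum of `Q_N(r)` is itself `d`-divisible). -/
abbrev EvenDowling (N r d k : ℕ) : Type := WithBot (evenlyColoured N r d k)

/-- `S_n^{(d,e,k)} = Q_{dn+e}(r,d,k) ∖ {⊥}`. -/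
abbrev SPoset (r d e k n : ℕ) : Type := {x : EvenDowling (d * n + e) r d k // x ≠ ⊥}

/-- The representative of `c_n`: empty zero block, a single nonzero block `{1, …, dn}` (no block at
all if `dn = 0`), and the label `⌊(i-1)k/(dn)⌋ + 1` on `i`; here `i - 1` is the value of the
element of `Fin (dn)` that stands for `i`. -/
def cPre (r d k n : ℕ) : GPrepartition (CyclicGroup r) (d * n) where
  zero := ∅
  π := ⊤
  γ i := Multiplicative.ofAdd ((((i : ℕ) * k) / (d * n) + 1 : ℕ) : ZMod r)

lemma cPre_isEvenlyColoured {r d k : ℕ} (hkr : k ∣ r) (hkd : k ∣ d) (n : ℕ) :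
    (cPre r d k n).IsEvenlyColoured d k := by
  intro B hB
  have hne : B.Nonempty := (cPre r d k n).π.nonempty_of_mem_parts hB
  have hB' : B = Finset.univ := by
    have h1 : B ∈ (⊤ : Finpartition (∅ : Finset (Fin (d * n)))ᶜ).parts := hB
    have h2 := Finpartition.parts_top_subset _ h1
    rw [Finset.mem_singleton.1 h2, Finset.compl_empty]
  subst hB'
  obtain ⟨i₀, -⟩ := hne
  have hN : 0 < d * n := Nat.zero_lt_of_lt i₀.2
  have hd : 0 < d := Nat.pos_of_mul_pos_right hN
  have hk : 0 < k := Nat.pos_of_dvd_of_pos hkd hd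
  obtain ⟨m, hm⟩ : k ∣ d * n := hkd.mul_right n
  have hmpos : 0 < m := Nat.pos_of_ne_zero (by rintro rfl; omega)
  have : NeZero k := ⟨hk.ne'⟩
  refine ⟨by simp, ?_⟩
  suffices h : ∀ j : ZMod k, (Finset.univ.filter fun a : Fin (d * n) =>
      ((((cPre r d k n).γ a).toAdd.cast : ZMod k)) = j).card = m from
    fun j j' => (h j).trans (h j').symm
  intro j
  have hlab : ∀ a : Fin (d * n), ((((cPre r d k n).γ a).toAdd.cast : ZMod k)) =
      (((a : ℕ) / m : ℕ) : ZMod k) + 1 := by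
    intro a
    have h1 : (a : ℕ) * k / (d * n) = (a : ℕ) / m := by
      calc (a : ℕ) * k / (d * n) = k * (a : ℕ) / (k * m) := by simp only [hm, mul_comm]
        _ = _ := Nat.mul_div_mul_left _ _ hk
    simp only [cPre, toAdd_ofAdd, h1]
    rw [ZMod.cast_natCast hkr]
    push_cast
    rfl
  have htk : (j - 1).val < k := ZMod.val_lt _
  have hbound : ∀ s < m, (j - 1).val * m + s < d * n := by
    intro s hs
    rw [hm]
    nlinarith
  symm
  rw [← Finset.card_range m]
  refine Finset.card_bij (fun s hs => ⟨(j - 1).val * m + s, hbound s (Finset.mem_range.1 hs)⟩)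
    ?_ ?_ ?_
  · intro s hs
    have hs' := Finset.mem_range.1 hs
    have h1 : ((j - 1).val * m + s) / m = (j - 1).val := by
      rw [mul_comm, Nat.mul_add_div hmpos, Nat.div_eq_of_lt hs', add_zero]
    simp [hlab, h1]
  · intro s hs s' hs' h
    simpa using h
  · intro a ha
    have ha' := (Finset.mem_filter.1 ha).2
    rw [hlab] at ha'
    have hlt : (a : ℕ) / m < k := by
      rw [Nat.div_lt_iff_lt_mul hmpos, ← hm]
      exact a.2
    have h1 : (a : ℕ) / m = (j - 1).val := by
      rw [← ha', add_sub_cancel_right, ZMod.val_natCast_of_lt hlt]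
    refine ⟨(a : ℕ) % m, Finset.mem_range.2 (Nat.mod_lt _ hmpos), ?_⟩
    ext
    change (j - 1).val * m + (a : ℕ) % m = a
    rw [← h1, mul_comm]
    exact Nat.div_add_mod _ _

/-- The element `c_n` of `Q_{dn}(r,d,k)`. -/
def cElement {r d k : ℕ} (hkr : k ∣ r) (hkd : k ∣ d) (n : ℕ) : EvenDowling (d * n) r d k :=
  ((⟨DowlingLattice.mk (cPre r d k n), _, rfl, cPre_isEvenlyColoured hkr hkd n⟩ :
    evenlyColoured (d * n) r d k) : WithBot (evenlyColoured (d * n) r d k))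

/-- `R'_n^{(d,k)}`: the elements of `Q_{dn}(r,d,k)` below `c_n`, except for the minimum `⊥`. -/
abbrev RPoset {r d k : ℕ} (hkr : k ∣ r) (hkd : k ∣ d) (n : ℕ) : Type :=
  {x : EvenDowling (d * n) r d k // x ≠ ⊥ ∧ x ≤ cElement hkr hkd n}

/-- Exponential structures `(R_1, R_2, …)` (the entry `R 0` is ignored).  The rank of `x` is
`Order.height x`, the largest length of a chain ending in `x` (so minimal elements have rank `0`);
the interval `[x, 1̂]` is `Set.Ici x`, the lower order ideal generated by `x` is `Set.Iic x`, and
the partition lattice `Π_m` is `Setoid (Fin m)`, ordered by refinement. -/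
structure IsExponentialStructure (R : ℕ → Type*) [∀ n, PartialOrder (R n)] : Prop where
  exists_top : ∀ n, 1 ≤ n → ∃ t : R n, ∀ x, x ≤ t
  card_maxChain : ∀ n, 1 ≤ n → ∀ s : Set (R n), IsMaxChain (· ≤ ·) s → s.encard = n
  upper : ∀ n, 1 ≤ n → ∀ x : R n, ∃ m < n, Order.height x = m ∧
    Nonempty (Set.Ici x ≃o Setoid (Fin (n - m)))
  /-- The type `(a_1, …, a_n)` of `x`; the multiplicity `a_{i+1}` is `a i`. -/
  lower : ∀ n, 1 ≤ n → ∀ x : R n, ∃ a : Fin n → ℕ, ∑ i : Fin n, ((i : ℕ) + 1) * a i = n ∧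
    Nonempty (Set.Iic x ≃o (∀ i : Fin n, Fin (a i) → R ((i : ℕ) + 1)))
  denominator : ∃ M : ℕ → ℕ, ∀ n, 1 ≤ n → {x : R n | IsMin x}.encard = M n

/-- `(S_0, S_1, …)` is an exponential Dowling structure for the group `G`, associated with the
exponential structure `(R_1, R_2, …)`. -/
structure IsExponentialDowlingStructure (G : Type*) [Group G] (S : ℕ → Type*)
    [∀ n, PartialOrder (S n)] (R : ℕ → Type*) [∀ n, PartialOrder (R n)] : Prop where
  base : IsExponentialStructure R
  exists_top : ∀ n, ∃ t : S n, ∀ x, x ≤ t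
  card_maxChain : ∀ n, ∀ s : Set (S n), IsMaxChain (· ≤ ·) s → s.encard = n + 1
  upper : ∀ n, ∀ x : S n, ∃ m ≤ n, Order.height x = m ∧
    Nonempty (Set.Ici x ≃o DowlingLattice G (n - m))
  /-- The type `(b; a_1, …, a_n)` of `x`; the multiplicity `a_{i+1}` is `a i`. -/
  lower : ∀ n, ∀ x : S n, ∃ (b : ℕ) (a : Fin n → ℕ), b + ∑ i : Fin n, ((i : ℕ) + 1) * a i = n ∧
    Nonempty (Set.Iic x ≃o S b × (∀ i : Fin n, Fin (a i) → R ((i : ℕ) + 1)))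
  denominator : ∃ N : ℕ → ℕ, ∀ n, {x : S n | IsMin x}.encard = N n

/-! ### Graded posets: heights and maximal chains from a rank function. -/

section Graded

variable {P : Type*} [PartialOrder P] {ρ : P → ℕ}

/-! A `G`-partition is encoded without representatives as a `DSetoid`: its zero block together with
the relation "the label of `a` is `g` times the label of `b`". Right multiplication on a block does
not change this relation, so no quotient is needed, and the Dowling order becomes plain inclusion
(`DowlingLattice.toDSetoid`). Even colouring is a condition on the images of the labels under the
reduction `colourHom` from `μ_r` to `ℤ/k`.

Upper intervals: a coarsening of `x` is the same thing as a `G`-partition of the set of nonzero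
blocks of `x` (`DSetoid.nonempty_Ici_ofMap`). Merging preserves even colouring
(`DowlingLattice.even_mono`), so the evenly coloured elements form an upper set and their upper
intervals are Dowling lattices. Below `c_n` there are no zero blocks and all labels are forced,
which leaves partition lattices (`EvenSetoid.nonempty_Ici_ker`).

Lower ideals: an element below `x` consists of an arbitrary even `G`-partition of the zero block of
`x` and an even set partition of each nonzero block, whose labels are inherited from `x`
(`DSetoid.exists_Iic_ofMap`). The poset of even set partitions of an evenly coloured set depends
only on the size of the set, because equal sizes allow a colour-preserving bijection
(`EvenSetoid.nonempty_congr_of_card`); for size `dn` it is `R'_n`. Since `e < d`, the zero block has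
size `db + e` for some `b`, and its factor is `S_b`.

Rank: each covering merge lowers the number of nonzero blocks by one, so the rank should be `n`
minus that number. What remains is that minimal elements have exactly `n` blocks. If `x` is minimal,
the product describing its lower ideal is a point. Since `R'_i` for `i ≥ 2` and `S_b` for `b ≥ 1`
are nontrivial, `b = 0` and every nonzero block has size `d`. Heights and the lengths of maximal
chains then follow from the general lemmas on rank functions. -/

lemma exists_lt_rank_eq (hstep : ∀ x y : P, x < y → ∃ z, x < z ∧ z ≤ y ∧ ρ z = ρ x + 1)
    {z x : P} (hzx : z < x) (hρ : StrictMono ρ) :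
    ∃ y, z ≤ y ∧ y < x ∧ ρ y + 1 = ρ x := by
  induction h : ρ x - ρ z using Nat.strong_induction_on generalizing z with | _ n ih => ?_
  -- Climb from `z` towards `x` one rank at a time; the last element before `x` is the required one.
  obtain ⟨w, hzw, hwx, hw⟩ := hstep z x hzx
  rcases hwx.eq_or_lt with rfl | hlt
  · exact ⟨z, le_rfl, hzx, hw.symm⟩
  · have h1 := hρ hlt
    obtain ⟨y, h2, h3, h4⟩ := ih _ (by omega) hlt rfl
    exact ⟨y, hzw.le.trans h2, h3, h4⟩

/-- Strict monotonicity bounds the height above. For the lower bound, an element of positive rank is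
not minimal, hence lies above an element of rank exactly one less, and induction applies. -/
lemma Order.height_eq_of_rank (hρ : StrictMono ρ)
    (hstep : ∀ x y : P, x < y → ∃ z, x < z ∧ z ≤ y ∧ ρ z = ρ x + 1)
    (hmin : ∀ x : P, IsMin x → ρ x = 0) (x : P) : Order.height x = ρ x := by
  induction h : ρ x using Nat.strong_induction_on generalizing x with | _ n ih => ?_
  apply le_antisymm
  · rw [Order.height_le_coe_iff]
    intro y hy
    have := hρ hy
    rw [ih (ρ y) (h ▸ this) y rfl]
    exact_mod_cast h ▸ this
  · rcases n with _ | n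
    · simp
    · have hx : ¬ IsMin x := fun hx => by have := hmin x hx; omega
      obtain ⟨z, hz⟩ := not_isMin_iff.1 hx
      obtain ⟨y, -, hy, hy'⟩ := exists_lt_rank_eq hstep hz hρ
      have := Order.height_add_one_le hy
      rw [ih (ρ y) (by omega) y rfl] at this
      have h2 : ρ y = n := by omega
      rw [h2] at this
      exact_mod_cast this

lemma IsMaxChain.mem_of_comparable {s : Set P} (hs : IsMaxChain (· ≤ ·) s) {z : P}
    (hz : ∀ w ∈ s, z ≤ w ∨ w ≤ z) : z ∈ s := by
  have h1 : IsChain (· ≤ ·) (insert z s) := hs.1.insert fun b hb _ => hz b hb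
  rw [hs.2 h1 (Set.subset_insert _ _)]
  exact Set.mem_insert _ _

/-- The rank is injective on a chain. A maximal chain contains the top and skips no rank, since a
gap could be filled by an element comparable with the whole chain. -/
lemma IsMaxChain.encard_of_rank {s : Set P} (hs : IsMaxChain (· ≤ ·) s) (hρ : StrictMono ρ)
    (hstep : ∀ x y : P, x < y → ∃ z, x < z ∧ z ≤ y ∧ ρ z = ρ x + 1)
    (hmin : ∀ x : P, IsMin x → ρ x = 0) {t : P} (ht : ∀ x, x ≤ t) :
    s.encard = ρ t + 1 := by
  have hpred : ∀ x ∈ s, ∀ i, ρ x = i + 1 → ∃ y ∈ s, ρ y = i := by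
    intro x hx i hi
    by_contra! hno
    -- Such a `z` is not in the chain, so by maximality it is incomparable to some member; members
    -- above `x` are harmless, so the obstruction lies below `x`.
    have key : ∀ z, z < x → ρ z = i → (∃ w ∈ s, w < x ∧ ¬ w ≤ z) := by
      intro z hzx hz
      by_contra! hcon
      refine hno z (hs.mem_of_comparable fun w hw => ?_) hz
      rcases hs.1.total hw hx with h | h
      · rcases h.eq_or_lt with rfl | h
        · exact Or.inl hzx.le
        · exact Or.inr (hcon w hw h)
      · exact Or.inl (hzx.le.trans h)
    by_cases hne : ∃ w ∈ s, w < x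
    -- Take the chain member `w` of largest rank below `x` and fill the gap between `w` and `x` by
    -- `z`. The obstruction to inserting `z` is a chain member strictly between `w` and `x`, against
    -- the choice of `w`.
    · let T : Set ℕ := {m | ∃ w ∈ s, w < x ∧ ρ w = m}
      have hT : T.Nonempty := let ⟨w, h1, h2⟩ := hne; ⟨_, w, h1, h2, rfl⟩
      have hTb : BddAbove T := ⟨ρ x, by rintro m ⟨w, -, h, rfl⟩; exact (hρ h).le⟩
      obtain ⟨w, hw, hwx, hwm⟩ := Nat.sSup_mem hT hTb
      obtain ⟨z, hwz, hzx, hz⟩ := exists_lt_rank_eq hstep hwx hρ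
      obtain ⟨v, hv, hvx, hvz⟩ := key z hzx (by omega)
      have hvw : ¬ v ≤ w := fun h => hvz (h.trans hwz)
      have hlt : w < v := lt_of_le_not_ge ((hs.1.total hw hv).resolve_right hvw) hvw
      have h1 := hρ hlt
      have h2 : ρ v ≤ sSup T := le_csSup hTb ⟨v, hv, hvx, rfl⟩
      omega
    · push Not at hne
      have hx' : ¬ IsMin x := fun h => by have := hmin x h; omega
      obtain ⟨z, hz⟩ := not_isMin_iff.1 hx'
      obtain ⟨y, -, hy, hy'⟩ := exists_lt_rank_eq hstep hz hρ
      obtain ⟨w, hw, hwx, -⟩ := key y hy (by omega)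
      exact hne w hw hwx
  have htop : t ∈ s := hs.mem_of_comparable fun w _ => Or.inr (ht w)
  have hall : ∀ j, j ≤ ρ t → ∃ y ∈ s, ρ y = ρ t - j := by
    intro j
    induction j with
    | zero => exact fun _ => ⟨t, htop, rfl⟩
    | succ j ih =>
      intro hj
      obtain ⟨y, hy, hyj⟩ := ih (by omega)
      exact hpred y hy _ (by omega)
  have hinj : Set.InjOn ρ s := by
    intro x hx y hy hxy
    by_contra hne
    rcases hs.1.total hx hy with h | h
    · exact (hρ (lt_of_le_of_ne h hne)).ne hxy
    · exact (hρ (lt_of_le_of_ne h (Ne.symm hne))).ne' hxy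
  have himg : ρ '' s = (Finset.range (ρ t + 1) : Finset ℕ) := by
    ext i
    simp only [Set.mem_image, Finset.coe_range, Set.mem_Iio]
    constructor
    · rintro ⟨x, -, rfl⟩
      exact Nat.lt_succ_of_le (hρ.monotone (ht x))
    · intro hi
      obtain ⟨y, hy, h⟩ := hall (ρ t - i) (by omega)
      exact ⟨y, hy, by omega⟩
  rw [← hinj.encard_image, himg, Set.encard_coe_eq_coe_finsetCard]
  simp

end Graded

/-- An order-reflecting and order-preserving surjection between partial orders is an order
isomorphism. -/
lemma exists_orderIso_of_surjective {X Y : Type*} [PartialOrder X] [PartialOrder Y] (f : X → Y)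
    (hle : ∀ x y, f x ≤ f y ↔ x ≤ y) (hf : Function.Surjective f) :
    ∃ φ : X ≃o Y, ∀ x, φ x = f x :=
  ⟨RelIso.ofSurjective (OrderEmbedding.ofMapLEIff f hle) hf, fun _ => rfl⟩

lemma nonempty_orderIso_of_surjective {X Y : Type*} [PartialOrder X] [PartialOrder Y] (f : X → Y)
    (hle : ∀ x y, f x ≤ f y ↔ x ≤ y) (hf : Function.Surjective f) : Nonempty (X ≃o Y) :=
  (exists_orderIso_of_surjective f hle hf).nonempty

/-- A product of posets over `B`, the factor at `b` being isomorphic to `R (s b)`, regrouped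
according to the value of `s`. -/
lemma nonempty_orderIso_pi_fiber {B I : Type*} [Finite B] {X : B → Type*} {R : I → Type*}
    [∀ b, PartialOrder (X b)] [∀ i, PartialOrder (R i)] (s : B → I)
    (ψ : ∀ b, Nonempty (X b ≃o R (s b))) :
    Nonempty ((∀ b, X b) ≃o ∀ i, Fin (Nat.card {b // s b = i}) → R i) := by
  -- Allowing any `i` equal to `s b` absorbs the transport along this equality into the isomorphism,
  -- so that no casts appear below.
  have ψ' : ∀ i b, s b = i → Nonempty (X b ≃o R i) := by
    rintro _ b rfl; exact ψ b
  let φ : ∀ i b, s b = i → (X b ≃o R i) := fun i b h => (ψ' i b h).some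
  let e : ∀ i, {b // s b = i} ≃ Fin (Nat.card {b // s b = i}) := fun i => Finite.equivFin _
  refine nonempty_orderIso_of_surjective
    (fun f i t => φ i ((e i).symm t).1 ((e i).symm t).2 (f ((e i).symm t).1)) ?_ ?_
  · intro f g
    constructor
    · intro h b
      have := h (s b) (e _ ⟨b, rfl⟩)
      simp only [OrderIso.le_iff_le] at this
      rwa [Equiv.symm_apply_apply] at this
    · intro h i t
      exact (φ i _ ((e i).symm t).2).monotone (h _)
  · intro g
    refine ⟨fun b => (φ (s b) b rfl).symm (g (s b) (e _ ⟨b, rfl⟩)), ?_⟩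
    funext i t
    have key : ∀ c : {b // s b = i}, φ i c.1 c.2
        ((φ (s c.1) c.1 rfl).symm (g (s c.1) (e _ ⟨c.1, rfl⟩))) = g i (e i c) := by
      rintro ⟨b, rfl⟩
      simp
    have := key ((e i).symm t)
    simpa using this

/-- The restriction of an order isomorphism to corresponding subtypes. -/
def OrderIso.subtypeCongr {X Y : Type*} [LE X] [LE Y] (e : X ≃o Y) {p : X → Prop} {q : Y → Prop}
    (h : ∀ x, p x ↔ q (e x)) : {x // p x} ≃o {y // q y} where
  toEquiv := e.toEquiv.subtypeEquiv h
  map_rel_iff' := e.map_rel_iff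

/-- Corresponding principal filters of isomorphic posets are isomorphic. -/
def OrderIso.IciCongr {X Y : Type*} [Preorder X] [Preorder Y] (e : X ≃o Y) {x : X} {y : Y}
    (h : e x = y) : Set.Ici x ≃o Set.Ici y :=
  e.subtypeCongr fun z => by simp [← h]

/-- Corresponding principal ideals of isomorphic posets are isomorphic. -/
def OrderIso.IicCongr {X Y : Type*} [Preorder X] [Preorder Y] (e : X ≃o Y) {x : X} {y : Y}
    (h : e x = y) : Set.Iic x ≃o Set.Iic y :=
  e.subtypeCongr fun z => by simp [← h]

/-- The product of two order isomorphisms. -/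
def OrderIso.prodCongr {X X' Y Y' : Type*} [LE X] [LE X'] [LE Y] [LE Y'] (e : X ≃o X')
    (f : Y ≃o Y') : X × Y ≃o X' × Y' where
  toEquiv := e.toEquiv.prodCongr f.toEquiv
  map_rel_iff' := and_congr e.le_iff_le f.le_iff_le

lemma IsMin.subsingleton_Iic {X : Type*} [PartialOrder X] {x : X} (h : IsMin x) :
    Subsingleton (Set.Iic x) :=
  ⟨fun a b => Subtype.ext ((h.eq_of_le a.2).trans (h.eq_of_le b.2).symm)⟩

/-! ### `G`-partitions as `G`-valued relations. -/

/-- A `G`-partition of `α`, given by its zero block `Z` and the relation `R`: here `R a b g` says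
that `a` and `b` both lie in the zero block, or lie in the same nonzero block with the label of
`a` equal to `g` times that of `b`. -/
@[ext]
structure DSetoid (α : Type*) (G : Type*) [Group G] where
  Z : α → Prop
  R : α → α → G → Prop
  refl : ∀ a, R a a 1
  symm : ∀ a b g, R a b g → R b a g⁻¹
  trans : ∀ a b c g h, R a b g → R b c h → R a c (g * h)
  zero : ∀ a b g, Z a → Z b → R a b g
  zero_of_rel : ∀ a b g, R a b g → Z a → Z b
  eq_one : ∀ a g, R a a g → g = 1 ∨ Z a

namespace DSetoid

variable {α β ζ ι : Type*} {G : Type*} [Group G]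

instance : PartialOrder (DSetoid α G) where
  le x y := (∀ a, x.Z a → y.Z a) ∧ ∀ a b g, x.R a b g → y.R a b g
  le_refl x := ⟨fun _ h => h, fun _ _ _ h => h⟩
  le_trans x y z h h' := ⟨fun a ha => h'.1 a (h.1 a ha), fun a b g H => h'.2 a b g (h.2 a b g H)⟩
  le_antisymm x y h h' := by
    ext a
    · exact ⟨h.1 a, h'.1 a⟩
    · exact ⟨h.2 _ _ _, h'.2 _ _ _⟩

instance [Finite α] [Finite G] : Finite (DSetoid α G) :=
  Finite.of_injective (fun x : DSetoid α G => (x.Z, x.R)) fun x y h => by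
    ext1
    · exact congrArg Prod.fst h
    · exact congrArg Prod.snd h

lemma zero_iff (x : DSetoid α G) {a b : α} {g : G} (h : x.R a b g) : x.Z a ↔ x.Z b :=
  ⟨x.zero_of_rel _ _ _ h, x.zero_of_rel _ _ _ (x.symm _ _ _ h)⟩

lemma rel_unique (x : DSetoid α G) {a b : α} {g h : G} (hg : x.R a b g) (hh : x.R a b h)
    (ha : ¬ x.Z a) : g = h := by
  have := x.eq_one _ _ (x.trans _ _ _ _ _ hg (x.symm _ _ _ hh))
  exact mul_inv_eq_one.1 (this.resolve_right ha)

/-- The `G`-partition with blocks the fibres of `f`, the fibre over `none` being the zero block,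
and with labels `γ`. -/
def ofMap (f : α → Option ι) (γ : α → G) : DSetoid α G where
  Z a := f a = none
  R a b g := f a = f b ∧ (f a = none ∨ γ a = g * γ b)
  refl a := by simp
  symm a b g := by
    rintro ⟨h1, h2⟩
    exact ⟨h1.symm, h2.imp (fun h => h1 ▸ h) fun h => by simp [h]⟩
  trans a b c g h := by
    rintro ⟨h1, h2⟩ ⟨h3, h4⟩
    refine ⟨h1.trans h3, ?_⟩
    rcases h2 with h2 | h2
    · exact Or.inl h2
    · rcases h4 with h4 | h4
      · exact Or.inl (h1.trans h4)
      · exact Or.inr (by rw [h2, h4, mul_assoc])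
  zero _ _ _ ha hb := ⟨ha.trans hb.symm, Or.inl ha⟩
  zero_of_rel _ b g h ha := h.1 ▸ ha
  eq_one _ _ h := by
    rcases h.2 with h | h
    · exact Or.inr h
    · exact Or.inl (by simpa using h.symm)

@[simp] lemma ofMap_Z {f : α → Option ι} {γ : α → G} {a : α} :
    (ofMap f γ).Z a ↔ f a = none := Iff.rfl

@[simp] lemma ofMap_R {f : α → Option ι} {γ : α → G} {a b : α} {g : G} :
    (ofMap f γ).R a b g ↔ f a = f b ∧ (f a = none ∨ γ a = g * γ b) := Iff.rfl

/-- Labels are recovered by choosing a representative in each nonzero block and labelling every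
element by the group element that relates it to its representative. -/
lemma exists_ofMap [Finite α] (x : DSetoid α G) :
    ∃ (m : ℕ) (f : α → Option (Fin m)) (γ : α → G), x = ofMap f γ := by
  classical
  let s : Setoid {a // ¬ x.Z a} :=
    { r := fun a b => ∃ g, x.R a b g
      iseqv := ⟨fun a => ⟨1, x.refl a⟩, fun ⟨g, h⟩ => ⟨g⁻¹, x.symm _ _ _ h⟩,
        fun ⟨g, h⟩ ⟨g', h'⟩ => ⟨g * g', x.trans _ _ _ _ _ h h'⟩⟩ }
  have hs : ∀ a b, s a b ↔ ∃ g, x.R a b g := fun _ _ => Iff.rfl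
  let e := Finite.equivFin (Quotient s)
  have hrep : ∀ a : {a // ¬ x.Z a}, ∃ g, x.R a (Quotient.out (Quotient.mk s a)).1 g := fun a =>
    (hs _ _).1 (Setoid.symm' s (Quotient.mk_out a))
  choose γ hγ using hrep
  refine ⟨_, fun a => if h : x.Z a then none else some (e (Quotient.mk s ⟨a, h⟩)),
    fun a => if h : x.Z a then 1 else γ ⟨a, h⟩, ?_⟩
  ext a b g
  · simp
  · rw [ofMap_R]
    by_cases ha : x.Z a <;> by_cases hb : x.Z b
    · simp [ha, hb, x.zero a b g ha hb]
    · simp only [ha, hb, dite_true, dite_false, reduceCtorEq, false_and, iff_false]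
      exact fun h => hb ((x.zero_iff h).1 ha)
    · simp only [ha, hb, dite_true, dite_false, reduceCtorEq, false_and, iff_false]
      exact fun h => ha ((x.zero_iff h).2 hb)
    · simp only [ha, hb, dite_false, reduceCtorEq, false_or, Option.some.injEq,
        EmbeddingLike.apply_eq_iff_eq]
      have h1 := hγ ⟨a, ha⟩
      have h2 := hγ ⟨b, hb⟩
      constructor
      · intro h
        have heq : Quotient.mk s ⟨a, ha⟩ = Quotient.mk s ⟨b, hb⟩ :=
          Quotient.sound ((hs _ _).2 ⟨g, h⟩)
        refine ⟨heq, ?_⟩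
        rw [← heq] at h2
        exact x.rel_unique h1 (x.trans _ _ _ _ _ h h2) ha
      · rintro ⟨heq, h⟩
        rw [← heq] at h2
        have := x.trans _ _ _ _ _ h1 (x.symm _ _ _ h2)
        rwa [h, mul_inv_cancel_right] at this

/-- The pullback of a `G`-partition along a map. -/
def comap (f : β → α) (x : DSetoid α G) : DSetoid β G where
  Z a := x.Z (f a)
  R a b g := x.R (f a) (f b) g
  refl _ := x.refl _
  symm _ _ := x.symm _ _
  trans _ _ _ := x.trans _ _ _
  zero _ _ := x.zero _ _
  zero_of_rel _ _ := x.zero_of_rel _ _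
  eq_one _ := x.eq_one _

@[simp] lemma comap_Z {f : β → α} {x : DSetoid α G} {a : β} : (comap f x).Z a ↔ x.Z (f a) := Iff.rfl

@[simp] lemma comap_R {f : β → α} {x : DSetoid α G} {a b : β} {g : G} :
    (comap f x).R a b g ↔ x.R (f a) (f b) g := Iff.rfl

/-- The relation of a `G`-partition, extended to the base point `none`. -/
def ext' (x : DSetoid ι G) : Option ι → Option ι → G → Prop
  | none, none, _ => True
  | none, some j, _ => x.Z j
  | some i, none, _ => x.Z i
  | some i, some j, g => x.R i j g

/-- The zero block of a `G`-partition, extended to the base point `none`. -/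
def extZ (x : DSetoid ι G) : Option ι → Prop
  | none => True
  | some i => x.Z i

/-- The `G`-partition of `α` obtained by merging the blocks of `ofMap f γ` according to a
`G`-partition of the index set of its blocks. -/
def pull (f : α → Option ι) (γ : α → G) (x : DSetoid ι G) : DSetoid α G where
  Z a := x.extZ (f a)
  -- If the blocks `i`, `j` carry labels `l i`, `l j`, the merged label of `a` is `γ a * l i`. The
  -- equation `γ a * l i = g * (γ b * l j)` says that `l i` is `(γ a)⁻¹ * g * γ b` times `l j`.
  R a b g := x.ext' (f a) (f b) ((γ a)⁻¹ * g * γ b)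
  refl a := by
    cases f a
    · trivial
    · simpa [ext'] using x.refl _
  symm a b g h := by
    cases ha : f a <;> cases hb : f b <;> simp only [ha, hb, ext'] at h ⊢
    · exact h
    · exact h
    · have := x.symm _ _ _ h
      simpa [mul_assoc] using this
  trans a b c g h h1 h2 := by
    cases ha : f a <;> cases hb : f b <;> cases hc : f c <;>
      simp only [ha, hb, hc, ext'] at h1 h2 ⊢
    · exact h2
    · exact (x.zero_iff h2).1 h1
    · exact h1
    · exact x.zero _ _ _ h1 h2
    · exact (x.zero_iff h1).2 h2
    · have := x.trans _ _ _ _ _ h1 h2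
      simpa [mul_assoc] using this
  zero a b g h1 h2 := by
    cases ha : f a <;> cases hb : f b <;> simp only [ha, hb, ext', extZ] at h1 h2 ⊢
    · exact h2
    · exact h1
    · exact x.zero _ _ _ h1 h2
  zero_of_rel a b g h1 h2 := by
    cases ha : f a <;> cases hb : f b <;> simp only [ha, hb, ext', extZ] at h1 h2 ⊢
    · exact h1
    · exact (x.zero_iff h1).1 h2
  eq_one a g h := by
    cases ha : f a <;> simp only [ha, ext', extZ] at h ⊢
    · simp
    · refine (x.eq_one _ _ h).imp_left fun h => ?_
      rw [mul_assoc, inv_mul_eq_one] at h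
      simpa using h.symm

lemma pull_Z_some {f : α → Option ι} {γ : α → G} {x : DSetoid ι G} {a : α} {i : ι}
    (ha : f a = some i) : (pull f γ x).Z a ↔ x.Z i := by
  change x.extZ (f a) ↔ _
  rw [ha]; rfl

lemma pull_Z_none {f : α → Option ι} {γ : α → G} {x : DSetoid ι G} {a : α}
    (ha : f a = none) : (pull f γ x).Z a := by
  change x.extZ (f a)
  rw [ha]; trivial

lemma pull_R_some {f : α → Option ι} {γ : α → G} {x : DSetoid ι G} {a b : α} {i j : ι} {g : G}
    (ha : f a = some i) (hb : f b = some j) :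
    (pull f γ x).R a b g ↔ x.R i j ((γ a)⁻¹ * g * γ b) := by
  change x.ext' (f a) (f b) _ ↔ _
  rw [ha, hb]; rfl

lemma ofMap_le_pull (f : α → Option ι) (γ : α → G) (x : DSetoid ι G) :
    ofMap f γ ≤ pull f γ x := by
  refine ⟨fun a ha => pull_Z_none ha, ?_⟩
  rintro a b g ⟨h1, h2⟩
  cases ha : f a with
  | none => exact DSetoid.zero _ _ _ _ (pull_Z_none ha) (pull_Z_none (h1 ▸ ha))
  | some i =>
    rw [pull_R_some ha (h1 ▸ ha)]
    rw [ha] at h2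
    simp only [reduceCtorEq, false_or] at h2
    rw [h2]
    simpa [mul_assoc] using x.refl i

lemma pull_le_pull {f : α → Option ι} (γ : α → G) (hf : ∀ i, ∃ a, f a = some i)
    {x y : DSetoid ι G} : pull f γ x ≤ pull f γ y ↔ x ≤ y := by
  constructor
  · intro h
    refine ⟨fun i hi => ?_, fun i j g hij => ?_⟩
    · obtain ⟨a, ha⟩ := hf i
      rw [← pull_Z_some (γ := γ) ha] at hi ⊢
      exact h.1 a hi
    · obtain ⟨a, ha⟩ := hf i
      obtain ⟨b, hb⟩ := hf j
      have h1 := (h.2 a b (γ a * g * (γ b)⁻¹))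
      rw [pull_R_some ha hb, pull_R_some ha hb] at h1
      simpa [mul_assoc] using h1 (by simpa [mul_assoc] using hij)
  · intro h
    refine ⟨fun a ha => ?_, fun a b g hab => ?_⟩
    · cases hfa : f a with
      | none => exact pull_Z_none hfa
      | some i =>
        rw [pull_Z_some hfa] at ha ⊢
        exact h.1 _ ha
    · change x.ext' _ _ _ at hab
      change y.ext' _ _ _
      cases ha : f a <;> cases hb : f b <;> simp only [ha, hb, ext'] at hab ⊢
      · exact h.1 _ hab
      · exact h.1 _ hab
      · exact h.2 _ _ _ hab

/-- A coarsening is determined by its restriction to one representative per nonzero block, after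
correcting for the labels of the representatives: every other element is tied to its representative
already in `ofMap f γ`. -/
lemma exists_pull_eq {f : α → Option ι} {γ : α → G} (hf : ∀ i, ∃ a, f a = some i)
    {y : DSetoid α G} (hy : ofMap f γ ≤ y) : ∃ x, pull f γ x = y := by
  choose rep hrep using hf
  let x : DSetoid ι G :=
    { Z := fun i => y.Z (rep i)
      R := fun i j g => y.R (rep i) (rep j) (γ (rep i) * g * (γ (rep j))⁻¹)
      refl := fun i => by simpa using y.refl _
      symm := fun i j g h => by simpa [mul_assoc] using y.symm _ _ _ h
      trans := fun i j k g h h1 h2 => by simpa [mul_assoc] using y.trans _ _ _ _ _ h1 h2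
      zero := fun i j g h1 h2 => y.zero _ _ _ h1 h2
      zero_of_rel := fun i j g h => y.zero_of_rel _ _ _ h
      eq_one := fun i g h => (y.eq_one _ _ h).imp_left fun h => by
        simpa [mul_inv_eq_one] using h }
  have hr : ∀ a i, f a = some i → y.R a (rep i) (γ a * (γ (rep i))⁻¹) := fun a i ha =>
    hy.2 _ _ _ ⟨by rw [ha, hrep], Or.inr (by simp)⟩
  have hz : ∀ a, f a = none → y.Z a := fun a ha => hy.1 a ha
  have hZ : ∀ a, (pull f γ x).Z a ↔ y.Z a := by
    intro a
    cases ha : f a with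
    | none => simp [pull_Z_none ha, hz a ha]
    | some i =>
      rw [pull_Z_some ha]
      exact (y.zero_iff (hr a i ha)).symm
  refine ⟨x, ?_⟩
  ext a b g
  · exact hZ a
  -- As soon as one of `a`, `b` is in the zero block, the relation carries no group element and only
  -- says that both are.
  · have hzz : ∀ w : DSetoid α G, w.Z a ∨ w.Z b → (w.R a b g ↔ w.Z a ∧ w.Z b) := by
      intro w h
      constructor
      · intro h'
        have := w.zero_iff h'
        tauto
      · exact fun h => w.zero _ _ _ h.1 h.2
    by_cases hcase : f a = none ∨ f b = none
    · have h1 : y.Z a ∨ y.Z b := hcase.imp (hz a) (hz b)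
      rw [hzz y h1, hzz _ (by rwa [hZ, hZ]), hZ, hZ]
    · push Not at hcase
      obtain ⟨i, hi⟩ := Option.ne_none_iff_exists'.1 hcase.1
      obtain ⟨j, hj⟩ := Option.ne_none_iff_exists'.1 hcase.2
      rw [pull_R_some hi hj]
      change y.R _ _ _ ↔ _
      have h1 := hr a i hi
      have h2 := hr b j hj
      constructor
      · intro h
        have := y.trans _ _ _ _ _ (y.trans _ _ _ _ _ h1 h) (y.symm _ _ _ h2)
        simpa [mul_assoc] using this
      · intro h
        have := y.trans _ _ _ _ _ (y.trans _ _ _ _ _ (y.symm _ _ _ h1) h) h2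
        simpa [mul_assoc] using this

/-- The source of (D2): nonzero blocks behave like single points when a `G`-partition is coarsened.
-/
theorem nonempty_Ici_ofMap {f : α → Option ι} (γ : α → G) (hf : ∀ i, ∃ a, f a = some i) :
    Nonempty (DSetoid ι G ≃o Set.Ici (ofMap f γ)) :=
  nonempty_orderIso_of_surjective (fun x => ⟨pull f γ x, ofMap_le_pull f γ x⟩)
    (fun _ _ => pull_le_pull γ hf)
    fun ⟨_, hy⟩ => (exists_pull_eq hf hy).imp fun _ h => Subtype.ext h

end DSetoid

/-! ### The Dowling lattice as the poset of `G`-valued relations. -/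

namespace GPrepartition

variable {G : Type*} {n : ℕ}

/-- The block of a prepartition containing a given element, `none` standing for the zero block. -/
noncomputable def blockMap (p : GPrepartition G n) (a : Fin n) : Option (Fin p.π.parts.card) :=
  if h : a ∈ p.zero then none
  else some (p.π.parts.equivFin ⟨p.π.part a, p.π.part_mem.2 (Finset.mem_compl.2 h)⟩)

lemma blockMap_eq_none (p : GPrepartition G n) {a : Fin n} : p.blockMap a = none ↔ a ∈ p.zero := by
  unfold blockMap
  split_ifs with h <;> simp [h]

lemma blockMap_eq_some (p : GPrepartition G n) {a : Fin n} {i : Fin p.π.parts.card} :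
    p.blockMap a = some i ↔ a ∈ (p.π.parts.equivFin.symm i).1 := by
  have hmem := (p.π.parts.equivFin.symm i).2
  unfold blockMap
  split_ifs with h
  · simp only [false_iff]
    exact fun h' => Finset.mem_compl.1 (p.π.le hmem h') h
  · rw [Option.some.injEq, ← Equiv.eq_symm_apply, Subtype.ext_iff]
    exact p.π.part_eq_iff_mem hmem

lemma exists_blockMap_eq_some (p : GPrepartition G n) (i : Fin p.π.parts.card) :
    ∃ a, p.blockMap a = some i := by
  obtain ⟨a, ha⟩ := p.π.nonempty_of_mem_parts (p.π.parts.equivFin.symm i).2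
  exact ⟨a, p.blockMap_eq_some.2 ha⟩

lemma exists_blockMap_of_mem (p : GPrepartition G n) {B : Finset (Fin n)} (hB : B ∈ p.π.parts) :
    ∃ i, ∀ a, a ∈ B ↔ p.blockMap a = some i :=
  ⟨p.π.parts.equivFin ⟨B, hB⟩, fun a => by rw [blockMap_eq_some]; simp⟩

variable [Group G]

/-- The `G`-partition represented by a prepartition. -/
noncomputable def toDSetoid (p : GPrepartition G n) : DSetoid (Fin n) G :=
  DSetoid.ofMap p.blockMap p.γ

lemma toDSetoid_le {p q : GPrepartition G n} : p.toDSetoid ≤ q.toDSetoid ↔ p.Refines q := by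
  constructor
  · rintro ⟨hZ, hR⟩
    refine ⟨fun a ha => q.blockMap_eq_none.1 (hZ a (p.blockMap_eq_none.2 ha)), fun B hB => ?_⟩
    obtain ⟨i, hi⟩ := p.exists_blockMap_of_mem hB
    obtain ⟨a, ha⟩ := p.π.nonempty_of_mem_parts hB
    have key : ∀ b ∈ B, q.blockMap a = q.blockMap b ∧
        (q.blockMap a = none ∨ q.γ a = p.γ a * (p.γ b)⁻¹ * q.γ b) := fun b hb =>
      hR a b (p.γ a * (p.γ b)⁻¹) ⟨((hi a).1 ha).trans ((hi b).1 hb).symm, Or.inr (by simp)⟩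
    cases haq : q.blockMap a with
    | none =>
      exact Or.inl fun b hb => q.blockMap_eq_none.1 ((key b hb).1 ▸ haq)
    | some j =>
      -- The translation taking the labels of `p` on `B` to those of `q` is read off at the fixed
      -- element `a`.
      refine Or.inr ⟨⟨_, (q.π.parts.equivFin.symm j).2, fun b hb =>
        q.blockMap_eq_some.1 ((key b hb).1 ▸ haq)⟩, (p.γ a)⁻¹ * q.γ a, fun b hb => ?_⟩
      have := (key b hb).2
      rw [haq] at this
      rw [this.resolve_left (by simp)]
      group
  · rintro ⟨hZ, hR⟩
    refine ⟨fun a ha => q.blockMap_eq_none.2 (hZ (p.blockMap_eq_none.1 ha)), ?_⟩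
    rintro a b g ⟨hab, hg⟩
    cases ha : p.blockMap a with
    | none =>
      have ha' := q.blockMap_eq_none.2 (hZ (p.blockMap_eq_none.1 ha))
      have hb' := q.blockMap_eq_none.2 (hZ (p.blockMap_eq_none.1 (hab ▸ ha)))
      exact ⟨ha'.trans hb'.symm, Or.inl ha'⟩
    | some i =>
      have hg' := hg.resolve_left (by simp [ha])
      have haB := p.blockMap_eq_some.1 ha
      have hbB := p.blockMap_eq_some.1 (hab ▸ ha)
      rcases hR _ (p.π.parts.equivFin.symm i).2 with h | ⟨⟨C, hC, hBC⟩, u, hu⟩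
      · have ha' := q.blockMap_eq_none.2 (h haB)
        have hb' := q.blockMap_eq_none.2 (h hbB)
        exact ⟨ha'.trans hb'.symm, Or.inl ha'⟩
      · obtain ⟨j, hj⟩ := q.exists_blockMap_of_mem hC
        refine ⟨((hj a).1 (hBC haB)).trans ((hj b).1 (hBC hbB)).symm, Or.inr ?_⟩
        rw [hu a haB, hu b hbB, hg', mul_assoc]

lemma exists_toDSetoid_eq (x : DSetoid (Fin n) G) : ∃ p : GPrepartition G n, p.toDSetoid = x := by
  classical
  obtain ⟨m, f, γ, rfl⟩ := x.exists_ofMap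
  let zero : Finset (Fin n) := Finset.univ.filter fun a => f a = none
  let P : Finpartition zeroᶜ := Finpartition.ofExistsUnique
    (zeroᶜ.image fun a => Finset.univ.filter fun b => f b = f a)
    (by
      intro B hB b hb
      obtain ⟨a, ha, rfl⟩ := Finset.mem_image.1 hB
      simp only [zero, Finset.mem_filter, Finset.mem_univ, true_and, Finset.mem_compl] at *
      rwa [hb])
    (by
      intro a ha
      refine ⟨_, ⟨Finset.mem_image_of_mem _ ha, by simp⟩, ?_⟩
      rintro B ⟨hB, haB⟩
      obtain ⟨b, hb, rfl⟩ := Finset.mem_image.1 hB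
      simp only [Finset.mem_filter, Finset.mem_univ, true_and] at haB
      simp only [haB])
    (by
      intro h
      obtain ⟨a, ha, h⟩ := Finset.mem_image.1 h
      have : a ∈ (∅ : Finset (Fin n)) := by rw [← h]; simp
      simp at this)
  let p : GPrepartition G n := ⟨zero, P, γ⟩
  have hnone : ∀ a, p.blockMap a = none ↔ f a = none := by
    intro a
    rw [blockMap_eq_none]
    simp [p, zero]
  have hsome : ∀ a b, p.blockMap a = p.blockMap b ↔ f a = f b := by
    intro a b
    cases ha : p.blockMap a with
    | none =>
      rw [hnone] at ha
      rw [ha, eq_comm, hnone, eq_comm]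
    | some i =>
      rw [eq_comm, blockMap_eq_some]
      rw [blockMap_eq_some] at ha
      generalize p.π.parts.equivFin.symm i = B at ha ⊢
      obtain ⟨B, hB⟩ := B
      obtain ⟨c, hc, rfl⟩ := Finset.mem_image.1 hB
      simp only [Finset.mem_filter, Finset.mem_univ, true_and] at ha ⊢
      rw [ha, eq_comm]
  refine ⟨p, ?_⟩
  ext a b g
  · exact hnone a
  · simp only [toDSetoid, DSetoid.ofMap_R, hnone, hsome]
    rfl

end GPrepartition

theorem DowlingLattice.nonempty_orderIso (G : Type*) [Group G] (n : ℕ) :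
    ∃ Φ : DowlingLattice G n ≃o DSetoid (Fin n) G, ∀ p, Φ (.mk p) = p.toDSetoid := by
  let F : DowlingLattice G n → DSetoid (Fin n) G := fun x =>
    Quotient.liftOn x GPrepartition.toDSetoid fun p q h => le_antisymm
      (GPrepartition.toDSetoid_le.2 h.refines) (GPrepartition.toDSetoid_le.2 h.symm.refines)
  have hF : ∀ x y, F x ≤ F y ↔ x ≤ y := fun x y =>
    Quotient.inductionOn₂ x y fun p q => GPrepartition.toDSetoid_le
  have hs : Function.Surjective F := fun y =>
    let ⟨p, hp⟩ := GPrepartition.exists_toDSetoid_eq y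
    ⟨.mk p, hp⟩
  exact ⟨RelIso.ofSurjective (OrderEmbedding.ofMapLEIff F hF) hs, fun p => rfl⟩

/-- The Dowling lattice as the poset of `DSetoid`s. -/
noncomputable def DowlingLattice.toDSetoid (G : Type*) [Group G] (n : ℕ) :
    DowlingLattice G n ≃o DSetoid (Fin n) G :=
  (DowlingLattice.nonempty_orderIso G n).choose

lemma DowlingLattice.toDSetoid_mk {G : Type*} [Group G] {n : ℕ} (p : GPrepartition G n) :
    DowlingLattice.toDSetoid G n (.mk p) = p.toDSetoid :=
  (DowlingLattice.nonempty_orderIso G n).choose_spec p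

instance {G : Type*} [Group G] [Finite G] {n : ℕ} : Finite (DowlingLattice G n) :=
  Finite.of_equiv _ (DowlingLattice.toDSetoid G n).symm.toEquiv

/-! ### Number of nonzero blocks and upper intervals in the Dowling lattice. -/

namespace DowlingLattice

variable {G : Type*} [Group G] {n : ℕ}

/-- The number of nonzero blocks. -/
def numBlocks (x : DowlingLattice G n) : ℕ :=
  Quotient.liftOn x (fun p => p.π.parts.card) fun _ _ h => by rw [h.2.1]

@[simp] lemma numBlocks_mk (p : GPrepartition G n) : numBlocks (mk p) = p.π.parts.card := rfl

lemma _root_.GPrepartition.Merge.card_parts {p q : GPrepartition G n} (h : p.Merge q) :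
    q.π.parts.card + 1 = p.π.parts.card := by
  rcases h with ⟨B, hB, -, hp, -⟩ | ⟨B, hB, C, hC, hBC, -, hp, -⟩
  · rw [hp, Finset.card_erase_add_one hB]
  · have hC' : C ∈ p.π.parts.erase B := Finset.mem_erase.2 ⟨hBC.symm, hC⟩
    rw [hp, Finset.card_insert_of_notMem, Finset.card_erase_add_one hC',
      Finset.card_erase_add_one hB]
    intro h
    simp only [Finset.mem_erase] at h
    obtain ⟨i, hi⟩ := p.π.nonempty_of_mem_parts hB
    exact h.2.1 (p.π.eq_of_mem_parts h.2.2 hB (Finset.mem_union_left _ hi) hi)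

lemma numBlocks_antitone {x y : DowlingLattice G n} (h : x ≤ y) : y.numBlocks ≤ x.numBlocks := by
  rw [le_iff_merges] at h
  induction h with
  | refl => exact le_rfl
  | tail _ h ih =>
    obtain ⟨p, q, rfl, rfl, h⟩ := h
    have := h.card_parts
    simp only [numBlocks_mk] at *
    omega

lemma exists_numBlocks_add_one {x y : DowlingLattice G n} (h : x < y) :
    ∃ z, x < z ∧ z ≤ y ∧ z.numBlocks + 1 = x.numBlocks := by
  induction x using Quotient.inductionOn with | _ p => ?_
  induction y using Quotient.inductionOn with | _ q => ?_
  obtain ⟨s, hs, hsq, -⟩ := exists_merge (p := p) (q := q) h.le (fun h' => h.not_ge h')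
  refine ⟨mk s, lt_of_le_of_ne hs.refines fun heq => ?_, hsq, hs.card_parts⟩
  have h1 := hs.card_parts
  have h2 := congrArg numBlocks heq
  change p.π.parts.card = s.π.parts.card at h2
  omega

lemma numBlocks_strictAnti {x y : DowlingLattice G n} (h : x < y) :
    y.numBlocks < x.numBlocks := by
  obtain ⟨z, -, h1, h2⟩ := exists_numBlocks_add_one h
  have := numBlocks_antitone h1
  omega

theorem nonempty_Ici (x : DowlingLattice G n) :
    Nonempty (Set.Ici x ≃o DowlingLattice G x.numBlocks) := by
  induction x using Quotient.inductionOn with | _ p => ?_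
  obtain ⟨φ⟩ := DSetoid.nonempty_Ici_ofMap p.γ p.exists_blockMap_eq_some
  exact ⟨((toDSetoid G n).IciCongr (toDSetoid_mk p)).trans (φ.symm.trans (toDSetoid G _).symm)⟩

end DowlingLattice

/-! ### Evenly coloured sets. -/

/-- The size of `B` is divisible by `d` and the colouring `c` takes every value on `B` equally
often. -/
def EvenlyColouredOn {α K : Type*} (d : ℕ) (c : α → K) (B : Set α) : Prop :=
  d ∣ B.ncard ∧ ∀ j j', {b ∈ B | c b = j}.ncard = {b ∈ B | c b = j'}.ncard

namespace EvenlyColouredOn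

variable {α β ι K : Type*} {d : ℕ}

lemma image_iff {c : α → K} {f : β → α} (hf : Function.Injective f) {B : Set β} :
    EvenlyColouredOn d c (f '' B) ↔ EvenlyColouredOn d (c ∘ f) B := by
  have h : ∀ j, {b ∈ f '' B | c b = j} = f '' {b ∈ B | (c ∘ f) b = j} := by
    intro j; ext b; constructor
    · rintro ⟨⟨a, ha, rfl⟩, h⟩; exact ⟨a, ⟨ha, h⟩, rfl⟩
    · rintro ⟨a, ⟨ha, h⟩, rfl⟩; exact ⟨⟨a, ha, rfl⟩, h⟩
  simp only [EvenlyColouredOn, h, Set.ncard_image_of_injective _ hf]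

lemma empty {c : α → K} : EvenlyColouredOn d c ∅ := by simp [EvenlyColouredOn]

lemma union [Finite α] {c : α → K} {B C : Set α} (hB : EvenlyColouredOn d c B) (hC : EvenlyColouredOn d c C)
    (h : Disjoint B C) : EvenlyColouredOn d c (B ∪ C) := by
  have h1 : ∀ j, {b ∈ B ∪ C | c b = j}.ncard =
      {b ∈ B | c b = j}.ncard + {b ∈ C | c b = j}.ncard := by
    intro j
    rw [← Set.ncard_union_eq (h.mono (Set.sep_subset _ _) (Set.sep_subset _ _))]
    congr 1; ext b; simp [or_and_right]
  refine ⟨?_, fun j j' => ?_⟩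
  · rw [Set.ncard_union_eq h]
    exact dvd_add hB.1 hC.1
  · rw [h1, h1, hB.2 j j', hC.2 j j']

lemma diff [Finite α] {c : α → K} {B C : Set α} (hB : EvenlyColouredOn d c B) (hC : EvenlyColouredOn d c C)
    (h : C ⊆ B) : EvenlyColouredOn d c (B \ C) := by
  have h1 : ∀ j, {b ∈ B \ C | c b = j}.ncard + {b ∈ C | c b = j}.ncard =
      {b ∈ B | c b = j}.ncard := by
    intro j
    rw [← Set.ncard_union_eq (Set.disjoint_left.2 fun b h1 h2 => h1.1.2 h2.1)]
    congr 1; ext b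
    have := @h b
    simp only [Set.mem_union, Set.mem_ofPred_eq, Set.mem_sdiff]
    tauto
  refine ⟨?_, fun j j' => ?_⟩
  · have := Set.ncard_sdiff_add_ncard_of_subset h
    exact (Nat.dvd_add_left hC.1).1 (this ▸ hB.1)
  · have h2 := h1 j
    have h3 := h1 j'
    rw [hB.2 j j', hC.2 j j'] at h2
    omega

lemma preimage [Finite α] {c : α → K} {f : α → ι} (h : ∀ i, EvenlyColouredOn d c (f ⁻¹' {i}))
    (I : Set ι) : EvenlyColouredOn d c (f ⁻¹' I) := by
  have key : ∀ J : Set ι, J.Finite → EvenlyColouredOn d c (f ⁻¹' J) := by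
    intro J hJ
    induction J, hJ using Set.Finite.induction_on with
    | empty => simpa using empty
    | @insert i J hi _ ih =>
      rw [Set.insert_eq, Set.preimage_union]
      exact (h i).union ih ((Set.disjoint_singleton_left.2 hi).preimage f)
  -- The index type may be infinite, but only the finite range of `f` contributes.
  rw [← Set.preimage_inter_range]
  exact key _ ((Set.finite_range f).inter_of_right I)

/-- Right multiplication by `u` permutes the colours, so equidistribution is unaffected. -/
lemma of_shift [Group K] {c c' : α → K} {B : Set α} (h : EvenlyColouredOn d c B) (u : K)
    (hu : ∀ b ∈ B, c' b = c b * u) : EvenlyColouredOn d c' B := by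
  refine ⟨h.1, fun j j' => ?_⟩
  have h1 : ∀ j, {b ∈ B | c' b = j} = {b ∈ B | c b = j * u⁻¹} := by
    intro j; ext b
    simp only [Set.mem_ofPred_eq, and_congr_right_iff]
    intro hb
    rw [hu b hb, eq_mul_inv_iff_mul_eq]
  rw [h1, h1]
  exact h.2 _ _

lemma _root_.Set.ncard_eq_card_mul [Finite α] [Finite K] {c : α → K} {B : Set α} {q : ℕ}
    (h : ∀ j, {b ∈ B | c b = j}.ncard = q) : B.ncard = Nat.card K * q := by
  classical
  have := Fintype.ofFinite α
  have := Fintype.ofFinite K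
  have h1 := Finset.card_eq_sum_card_fiberwise (f := c) (s := B.toFinset) (t := Finset.univ)
    (fun _ _ => by simp)
  rw [Set.ncard_eq_toFinset_card' B, h1, Finset.sum_congr rfl (g := fun _ => q)]
  · simp [Nat.card_eq_fintype_card]
  · intro j _
    rw [← h j, Set.ncard_eq_toFinset_card']
    congr 1; ext b; simp

lemma card_mul_ncard [Finite α] [Finite K] {c : α → K} {B : Set α} (h : EvenlyColouredOn d c B)
    (j : K) : Nat.card K * {b ∈ B | c b = j}.ncard = B.ncard :=
  (Set.ncard_eq_card_mul fun j' => h.2 j' j).symm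

/-- Write `d = |K| q`. Every colour class of `B` has the same size, which is at least `q` because
`B` has at least `d` elements; the subset takes `q` elements of each colour. -/
lemma exists_subset [Finite α] [Finite K] {c : α → K} {B : Set α} (h : EvenlyColouredOn d c B)
    (hK : Nat.card K ∣ d) (hd : 0 < d) (hB : d ≤ B.ncard) :
    ∃ A ⊆ B, EvenlyColouredOn d c A ∧ A.ncard = d := by
  obtain ⟨q, rfl⟩ := hK
  have hK : 0 < Nat.card K := Nat.pos_of_mul_pos_right hd
  have hq : ∀ j, q ≤ {b ∈ B | c b = j}.ncard := fun j =>
    Nat.le_of_mul_le_mul_left ((h.card_mul_ncard j).symm ▸ hB) hK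
  choose A hA hAq using fun j => Set.exists_subset_card_eq (hq j)
  have h1 : ∀ j, {b ∈ {a | a ∈ A (c a)} | c b = j} = A j := by
    intro j
    ext b
    constructor
    · rintro ⟨hb, rfl⟩
      exact hb
    · intro hb
      obtain rfl : c b = j := (hA j hb).2
      exact ⟨hb, rfl⟩
  have h2 : {a | a ∈ A (c a)}.ncard = Nat.card K * q :=
    Set.ncard_eq_card_mul (c := c) fun j => by rw [h1, hAq]
  exact ⟨{a | a ∈ A (c a)}, fun a ha => (hA _ ha).1,
    ⟨by rw [h2], fun j j' => by rw [h1, h1, hAq, hAq]⟩, h2⟩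

end EvenlyColouredOn

/-! ### Evenly coloured set partitions. -/

/-- The set partitions of `α` all of whose blocks are balanced. -/
abbrev EvenSetoid {α K : Type*} (d : ℕ) (c : α → K) : Type _ :=
  {s : Setoid α // ∀ a, EvenlyColouredOn d c {b | s a b}}

namespace EvenSetoid

variable {α β ι K : Type*} {d : ℕ}

lemma balanced_fiber {c : α → K} {f : α → ι} (h : ∀ a, EvenlyColouredOn d c {b | Setoid.ker f a b}) (i : ι) :
    EvenlyColouredOn d c (f ⁻¹' {i}) := by
  by_cases hi : ∃ a, f a = i
  · obtain ⟨a, rfl⟩ := hi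
    convert h a using 1
    ext b
    simp [Setoid.ker_def, eq_comm]
  · convert EvenlyColouredOn.empty
    ext b
    simpa using fun hb => hi ⟨b, hb⟩

/-- The source of (E2): a coarsening is an arbitrary partition of the set of blocks, evenness being
automatic for disjoint unions of even blocks. -/
theorem nonempty_Ici_ker [Finite α] {c : α → K} {f : α → ι} (hf : Function.Surjective f)
    (h : ∀ a, EvenlyColouredOn d c {b | Setoid.ker f a b}) :
    Nonempty (Set.Ici (⟨Setoid.ker f, h⟩ : EvenSetoid d c) ≃o Setoid ι) := by
  have hr : Function.RightInverse (Function.surjInv hf) f := Function.rightInverse_surjInv hf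
  refine Nonempty.map OrderIso.symm (nonempty_orderIso_of_surjective
    (fun s : Setoid ι => (⟨⟨s.comap f, fun a =>
      EvenlyColouredOn.preimage (balanced_fiber h) {i | s (f a) i}⟩, fun a b hab => by
        change s (f a) (f b)
        rw [show f a = f b from hab]⟩ :
      Set.Ici (⟨Setoid.ker f, h⟩ : EvenSetoid d c))) (fun s t => ?_) ?_)
  · constructor
    · intro H i j hij
      obtain ⟨a, rfl⟩ := hf i
      obtain ⟨b, rfl⟩ := hf j
      exact @H a b hij
    · exact fun H a b hab => @H _ _ hab
  · rintro ⟨⟨t, ht⟩, hle⟩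
    have hle' : ∀ a b, f a = f b → t a b := fun a b hab => @hle a b hab
    refine ⟨t.comap (Function.surjInv hf), ?_⟩
    ext a b
    change t (Function.surjInv hf (f a)) (Function.surjInv hf (f b)) ↔ t a b
    have h1 := hle' _ _ (hr (f a))
    have h2 := hle' _ _ (hr (f b))
    exact ⟨fun H => t.trans' (t.trans' (t.symm' h1) H) h2,
      fun H => t.trans' (t.trans' h1 H) (t.symm' h2)⟩

/-- The source of (E3): a refinement is chosen independently on each fibre, and each of its blocks
lies in a single fibre, so evenness can be tested there. -/
theorem nonempty_Iic_ker {c : α → K} {f : α → ι}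
    (h : ∀ a, EvenlyColouredOn d c {b | Setoid.ker f a b}) :
    Nonempty (Set.Iic (⟨Setoid.ker f, h⟩ : EvenSetoid d c) ≃o
      ∀ i, EvenSetoid d (fun a : {a // f a = i} => c a)) := by
  have himg : ∀ t : Setoid α, t ≤ Setoid.ker f → ∀ i (a : {a // f a = i}),
      {b | t a.1 b} = Subtype.val '' {b : {a // f a = i} | t.comap Subtype.val a b} := by
    rintro t ht i ⟨a, rfl⟩
    ext b
    constructor
    · intro hb
      exact ⟨⟨b, (@ht _ _ hb).symm⟩, hb, rfl⟩
    · rintro ⟨b, hb, rfl⟩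
      exact hb
  have hbal : ∀ t : Setoid α, t ≤ Setoid.ker f → ∀ i (a : {a // f a = i}),
      EvenlyColouredOn d c {b | t a.1 b} ↔ EvenlyColouredOn d (fun a : {a // f a = i} => c a)
        {b | t.comap Subtype.val a b} := fun t ht i a => by
    rw [himg t ht, EvenlyColouredOn.image_iff Subtype.val_injective]
    rfl
  refine nonempty_orderIso_of_surjective (fun t i => ⟨t.1.1.comap Subtype.val, fun a =>
    (hbal t.1.1 t.2 i a).1 (t.1.2 a)⟩) ?_ ?_
  · rintro ⟨⟨s, hs⟩, hs'⟩ ⟨⟨t, ht⟩, ht'⟩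
    constructor
    · intro H a b hab
      exact @H (f b) ⟨a, @hs' _ _ hab⟩ ⟨b, rfl⟩ hab
    · exact fun H i a b hab => @H _ _ hab
  · intro t
    let s : Setoid α :=
      { r := fun a b => ∃ (i : ι) (ha : f a = i) (hb : f b = i), (t i).1 ⟨a, ha⟩ ⟨b, hb⟩
        iseqv := ⟨fun a => ⟨f a, rfl, rfl, (t _).1.refl' _⟩,
          fun ⟨i, ha, hb, H⟩ => ⟨i, hb, ha, (t i).1.symm' H⟩, by
            rintro a b e ⟨i, ha, rfl, H⟩ ⟨j, hb, he, H'⟩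
            subst hb
            exact ⟨_, ha, he, (t _).1.trans' H H'⟩⟩ }
    have hs : ∀ a b, s a b ↔ ∃ (i : ι) (ha : f a = i) (hb : f b = i), (t i).1 ⟨a, ha⟩ ⟨b, hb⟩ :=
      fun _ _ => Iff.rfl
    have hle : s ≤ Setoid.ker f := by
      rintro a b ⟨i, ha, hb, -⟩
      exact ha.trans hb.symm
    have hcomap : ∀ i, s.comap Subtype.val = (t i).1 := by
      intro i
      ext ⟨a, ha⟩ ⟨b, hb⟩
      rw [Setoid.comap_rel, hs]
      constructor
      · rintro ⟨j, hj, _, H⟩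
        obtain rfl : i = j := ha.symm.trans hj
        exact H
      · exact fun H => ⟨i, ha, hb, H⟩
    refine ⟨⟨⟨s, fun a => ?_⟩, hle⟩, ?_⟩
    · rw [hbal s hle (f a) ⟨a, rfl⟩, hcomap]
      exact (t _).2 _
    · funext i
      exact Subtype.ext (hcomap i)

theorem nonempty_congr (e : α ≃ β) {c : α → K} {c' : β → K} (h : ∀ a, c' (e a) = c a) :
    Nonempty (EvenSetoid d c ≃o EvenSetoid d c') := by
  obtain rfl : c = c' ∘ e := funext fun a => (h a).symm
  have hbal : ∀ (s : Setoid β) a, EvenlyColouredOn d c' {b | s (e a) b} ↔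
      EvenlyColouredOn d (c' ∘ e) {b | s.comap e a b} := by
    intro s a
    rw [← EvenlyColouredOn.image_iff e.injective]
    congr! 1
    ext b
    constructor
    · intro hb
      exact ⟨e.symm b, by simpa [Setoid.comap_rel] using hb, by simp⟩
    · rintro ⟨b, hb, rfl⟩
      exact hb
  refine Nonempty.map OrderIso.symm (nonempty_orderIso_of_surjective
    (fun s : EvenSetoid d c' => (⟨s.1.comap e, fun a => (hbal s.1 a).1 (s.2 _)⟩ :
      EvenSetoid d (c' ∘ e))) (fun s t => ?_) ?_)
  · constructor
    · intro H a b hab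
      have := @H (e.symm a) (e.symm b) (by simpa [Setoid.comap_rel] using hab)
      simpa [Setoid.comap_rel] using this
    · exact fun H a b hab => @H _ _ hab
  · intro t
    have ht : (t.1.comap e.symm).comap e = t.1 := by
      ext a b
      simp [Setoid.comap_rel]
    refine ⟨⟨t.1.comap e.symm, fun b => ?_⟩, Subtype.ext ht⟩
    obtain ⟨a, rfl⟩ := e.surjective b
    rw [hbal, ht]
    exact t.2 a

/-- Each colour class has size `|α| / |K|` on both sides, so the classes can be matched colour by
colour. This is why types need to record only the sizes of blocks. -/
theorem nonempty_congr_of_card [Finite α] [Finite β] [Finite K] [Nonempty K] {c : α → K}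
    {c' : β → K} (h : EvenlyColouredOn d c Set.univ) (h' : EvenlyColouredOn d c' Set.univ)
    (hcard : Nat.card α = Nat.card β) : Nonempty (EvenSetoid d c ≃o EvenSetoid d c') := by
  have hfib : ∀ j, Nonempty ({a // c a = j} ≃ {b // c' b = j}) := by
    intro j
    rw [← Finite.card_eq]
    have h1 := h.card_mul_ncard j
    have h2 := h'.card_mul_ncard j
    rw [Set.ncard_univ] at h1 h2
    have h3 := Nat.eq_of_mul_eq_mul_left Nat.card_pos (h1.trans (hcard.trans h2.symm))
    simp only [Set.mem_univ, true_and, ← Nat.card_coe_set_eq] at h3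
    exact h3
  exact nonempty_congr (Equiv.ofFiberEquiv fun j => (hfib j).some)
    fun a => Equiv.ofFiberEquiv_map _ a

end EvenSetoid

/-! ### Evenly coloured `G`-partitions and their lower ideals. -/

namespace DSetoid

variable {α β ζ ι G K : Type*} [Group G] [Group K] {d : ℕ}

/-- The nonzero block of `a` is evenly coloured, the colours being read off relative to `a`. -/
def EvenAt (d : ℕ) (χ : G →* K) (x : DSetoid α G) (a : α) : Prop :=
  d ∣ {b | ∃ g, x.R a b g}.ncard ∧
    ∀ j j', {b | ∃ g, x.R a b g ∧ χ g = j}.ncard = {b | ∃ g, x.R a b g ∧ χ g = j'}.ncard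

/-- All nonzero blocks are evenly coloured. -/
def Even (d : ℕ) (χ : G →* K) (x : DSetoid α G) : Prop := ∀ a, ¬ x.Z a → x.EvenAt d χ a

/-- The colour of `b` relative to `a` is `χ (γ a) * (χ (γ b))⁻¹`, so relative and absolute colours
differ by the permutation `j ↦ j⁻¹ * χ (γ a)` of `K`. -/
lemma evenAt_iff {χ : G →* K} {x : DSetoid α G} {a : α} (γ : α → G)
    (h : ∀ b g, x.R a b g → γ a = g * γ b) :
    x.EvenAt d χ a ↔ EvenlyColouredOn d (χ ∘ γ) {b | ∃ g, x.R a b g} := by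
  have h1 : ∀ j, {b | ∃ g, x.R a b g ∧ χ g = j} =
      {b ∈ {b | ∃ g, x.R a b g} | (χ ∘ γ) b = j⁻¹ * χ (γ a)} := by
    intro j
    ext b
    simp only [Set.mem_ofPred_eq, Function.comp]
    constructor
    · rintro ⟨g, hg, rfl⟩
      exact ⟨⟨g, hg⟩, by rw [h b g hg]; simp⟩
    · rintro ⟨⟨g, hg⟩, hj⟩
      refine ⟨g, hg, ?_⟩
      rw [h b g hg, map_mul, ← mul_assoc] at hj
      have := mul_eq_right.1 hj.symm
      rw [inv_mul_eq_one] at this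
      exact this.symm
  unfold EvenAt EvenlyColouredOn
  simp only [h1]
  refine and_congr_right fun _ => ⟨fun H j j' => ?_, fun H j j' => H _ _⟩
  -- These are the preimages of `j` and `j'` under that permutation.
  simpa using H (χ (γ a) * j⁻¹) (χ (γ a) * j'⁻¹)

lemma even_ofMap {χ : G →* K} {f : α → Option ι} {γ : α → G} :
    (ofMap f γ).Even d χ ↔ ∀ i, EvenlyColouredOn d (χ ∘ γ) {a | f a = some i} := by
  have key : ∀ a i, f a = some i → ((ofMap f γ).EvenAt d χ a ↔
      EvenlyColouredOn d (χ ∘ γ) {a | f a = some i}) := by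
    intro a i ha
    rw [evenAt_iff γ]
    · have : {b | ∃ g, (ofMap f γ).R a b g} = {a | f a = some i} := by
        ext b
        simp only [ofMap_R, Set.mem_ofPred_eq, ha]
        constructor
        · rintro ⟨g, h, -⟩
          exact h.symm
        · exact fun h => ⟨γ a * (γ b)⁻¹, h.symm, Or.inr (by simp)⟩
      rw [this]
    · rintro b g ⟨-, h⟩
      exact h.resolve_left (by simp [ha])
  constructor
  · intro h i
    by_cases hi : ∃ a, f a = some i
    · obtain ⟨a, ha⟩ := hi
      exact (key a i ha).1 (h a (by simp [ha]))
    · convert EvenlyColouredOn.empty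
      ext b
      simpa using fun hb => hi ⟨b, hb⟩
  · intro h a ha
    obtain ⟨i, hi⟩ := Option.ne_none_iff_exists'.1 ha
    exact (key a i hi).2 (h i)

/-- The set partition of (a subset of) the complement of the zero block into the nonzero blocks. -/
def blockSetoid (f : β → α) (x : DSetoid α G) : Setoid β where
  r a b := ∃ g, x.R (f a) (f b) g
  iseqv := ⟨fun _ => ⟨1, x.refl _⟩, fun ⟨g, h⟩ => ⟨g⁻¹, x.symm _ _ _ h⟩,
    fun ⟨g, h⟩ ⟨g', h'⟩ => ⟨g * g', x.trans _ _ _ _ _ h h'⟩⟩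

lemma blockSetoid_def {f : β → α} {x : DSetoid α G} {a b : β} :
    x.blockSetoid f a b ↔ ∃ g, x.R (f a) (f b) g := Iff.rfl

/-- The `G`-partition with zero block that of `w` and with nonzero blocks those of `w` and, for
the labelling `γ`, those of `t`. -/
def glue {iz : ζ → α} {ib : β → α} (hz : Function.Injective iz) (hb : Function.Injective ib)
    (hzb : ∀ z u, iz z ≠ ib u) (hcov : ∀ a, (∃ z, iz z = a) ∨ ∃ u, ib u = a)
    (γ : α → G) (w : DSetoid ζ G) (t : Setoid β) : DSetoid α G where
  Z a := ∃ z, iz z = a ∧ w.Z z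
  R a b g := (∃ z z', iz z = a ∧ iz z' = b ∧ w.R z z' g) ∨
    ∃ u v, ib u = a ∧ ib v = b ∧ t u v ∧ γ a = g * γ b
  refl a := by
    rcases hcov a with ⟨z, rfl⟩ | ⟨u, rfl⟩
    · exact Or.inl ⟨z, z, rfl, rfl, w.refl z⟩
    · exact Or.inr ⟨u, u, rfl, rfl, t.refl' u, by simp⟩
  symm a b g := by
    rintro (⟨z, z', rfl, rfl, h⟩ | ⟨u, v, rfl, rfl, h, h'⟩)
    · exact Or.inl ⟨z', z, rfl, rfl, w.symm _ _ _ h⟩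
    · exact Or.inr ⟨v, u, rfl, rfl, t.symm' h, by simp [h']⟩
  trans a b c g g' := by
    rintro (⟨z, z', rfl, rfl, h⟩ | ⟨u, v, rfl, rfl, h, h'⟩)
      (⟨y, y', hy, rfl, k⟩ | ⟨p, q, hp, rfl, k, k'⟩)
    · obtain rfl := hz hy
      exact Or.inl ⟨_, _, rfl, rfl, w.trans _ _ _ _ _ h k⟩
    · exact absurd hp.symm (hzb _ _)
    · exact absurd hy (hzb _ _)
    · obtain rfl := hb hp
      exact Or.inr ⟨_, _, rfl, rfl, t.trans' h k, by rw [h', k', mul_assoc]⟩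
  zero a b g := by
    rintro ⟨z, rfl, h⟩ ⟨z', rfl, h'⟩
    exact Or.inl ⟨z, z', rfl, rfl, w.zero _ _ _ h h'⟩
  zero_of_rel a b g := by
    rintro (⟨z, z', rfl, rfl, h⟩ | ⟨u, v, rfl, rfl, h, h'⟩) ⟨y, hy, k⟩
    · obtain rfl := hz hy
      exact ⟨_, rfl, w.zero_of_rel _ _ _ h k⟩
    · exact absurd hy (hzb _ _)
  eq_one a g := by
    rintro (⟨z, z', rfl, hz', h⟩ | ⟨u, v, rfl, -, -, h'⟩)
    · obtain rfl := hz hz'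
      exact (w.eq_one _ _ h).imp_right fun h => ⟨_, rfl, h⟩
    · exact Or.inl (by simpa using h'.symm)

/-- The principal ideal of a `G`-partition: the zero block is decomposed into an arbitrary
`G`-partition, the nonzero blocks are decomposed into set partitions. -/
theorem exists_Iic_ofMap {χ : G →* K} {f : α → Option ι} {γ : α → G} {iz : ζ → α} {ib : β → α}
    (hz : Function.Injective iz) (hb : Function.Injective ib) {cls : β → ι}
    (hfz : ∀ z, f (iz z) = none) (hfb : ∀ u, f (ib u) = some (cls u))
    (hcov : ∀ a, (∃ z, iz z = a) ∨ ∃ u, ib u = a) (hx : (ofMap f γ).Even d χ) :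
    ∃ hs : ∀ u, EvenlyColouredOn d (χ ∘ γ ∘ ib) {v | Setoid.ker cls u v},
    ∃ Φ : Set.Iic (⟨ofMap f γ, hx⟩ : {y : DSetoid α G // y.Even d χ}) ≃o
      {w : DSetoid ζ G // w.Even d χ} ×
        Set.Iic (⟨Setoid.ker cls, hs⟩ : EvenSetoid d (χ ∘ γ ∘ ib)),
      ∀ y, (Φ y).2.1.1 = y.1.1.blockSetoid ib := by
  have hzb : ∀ z u, iz z ≠ ib u := fun z u h => by
    have h1 := hfz z
    rw [h, hfb u] at h1
    exact absurd h1 (by simp)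
  -- Below `ofMap f γ` no relation joins its zero block to the rest, so blocks inside the zero block
  -- can be tested for evenness there.
  have evenz : ∀ y : DSetoid α G, y ≤ ofMap f γ → ∀ z,
      (y.EvenAt d χ (iz z) ↔ (y.comap iz).EvenAt d χ z) := by
    intro y hy z
    have h1 : ∀ P : G → Prop, {b | ∃ g, y.R (iz z) b g ∧ P g} =
        iz '' {z' | ∃ g, (y.comap iz).R z z' g ∧ P g} := by
      intro P
      ext b
      constructor
      · rintro ⟨g, hg, hP⟩
        rcases hcov b with ⟨z', rfl⟩ | ⟨u, rfl⟩
        · exact ⟨z', ⟨g, hg, hP⟩, rfl⟩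
        · have := (hy.2 _ _ _ hg).1
          rw [hfz, hfb] at this
          exact absurd this (by simp)
      · rintro ⟨z', ⟨g, hg, hP⟩, rfl⟩
        exact ⟨g, hg, hP⟩
    have h2 := h1 fun _ => True
    simp only [and_true] at h2
    unfold EvenAt
    simp only [h1, h2, Set.ncard_image_of_injective _ hz]
  have hnz : ∀ y : DSetoid α G, y ≤ ofMap f γ → ∀ u, ¬ y.Z (ib u) := by
    intro y hy u h
    have := hy.1 _ h
    rw [ofMap_Z, hfb] at this
    exact absurd this (by simp)
  -- Outside the zero block of `ofMap f γ` the group element of a relation is forced by `γ`; a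
  -- refinement is there merely a set partition.
  have hlab : ∀ y : DSetoid α G, y ≤ ofMap f γ → ∀ u b g, y.R (ib u) b g →
      f b = some (cls u) ∧ γ (ib u) = g * γ b := by
    intro y hy u b g h
    have := hy.2 _ _ _ h
    rw [ofMap_R, hfb] at this
    exact ⟨this.1.symm, this.2.resolve_left (by simp)⟩
  have evenb : ∀ y : DSetoid α G, y ≤ ofMap f γ → ∀ u,
      (y.EvenAt d χ (ib u) ↔ EvenlyColouredOn d (χ ∘ γ ∘ ib) {v | y.blockSetoid ib u v}) := by
    intro y hy u
    rw [evenAt_iff γ fun b g h => (hlab y hy u b g h).2, ← Function.comp_assoc,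
      ← EvenlyColouredOn.image_iff hb]
    congr! 1
    ext b
    constructor
    · rintro ⟨g, hg⟩
      rcases hcov b with ⟨z', rfl⟩ | ⟨v, rfl⟩
      · have := (hlab y hy u _ g hg).1
        rw [hfz] at this
        exact absurd this (by simp)
      · exact ⟨v, ⟨g, hg⟩, rfl⟩
    · rintro ⟨v, h, rfl⟩
      exact h
  have hker : ∀ y : DSetoid α G, y ≤ ofMap f γ → y.blockSetoid ib ≤ Setoid.ker cls := by
    rintro y hy u v ⟨g, hg⟩
    have := (hlab y hy u _ g hg).1
    rw [hfb] at this
    exact (Option.some.inj this).symm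
  have hkerx : (ofMap f γ).blockSetoid ib = Setoid.ker cls := by
    refine le_antisymm (hker _ le_rfl) fun u v huv => ?_
    refine ⟨γ (ib u) * (γ (ib v))⁻¹, ?_, Or.inr (by simp)⟩
    rw [hfb, hfb, show cls u = cls v from huv]
  have hs : ∀ u, EvenlyColouredOn d (χ ∘ γ ∘ ib) {v | Setoid.ker cls u v} := by
    intro u
    rw [← hkerx]
    exact (evenb _ le_rfl u).1 (hx _ (hnz _ le_rfl u))
  have key := exists_orderIso_of_surjective
    (X := Set.Iic (⟨ofMap f γ, hx⟩ : {y : DSetoid α G // y.Even d χ})) (fun y =>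
    ((⟨y.1.1.comap iz, fun z hz => (evenz _ y.2 z).1 (y.1.2 _ hz)⟩,
      ⟨⟨y.1.1.blockSetoid ib, fun u => (evenb _ y.2 u).1 (y.1.2 _ (hnz _ y.2 u))⟩,
        hker _ y.2⟩) : {w : DSetoid ζ G // w.Even d χ} ×
        Set.Iic (⟨Setoid.ker cls, hs⟩ : EvenSetoid d (χ ∘ γ ∘ ib)))) ?_ ?_
  · obtain ⟨Φ, hΦ⟩ := key
    exact ⟨hs, Φ, fun y => by rw [hΦ]⟩
  · rintro ⟨⟨y, hy⟩, hyx⟩ ⟨⟨y', hy'⟩, hyx'⟩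
    change y ≤ ofMap f γ at hyx
    change y' ≤ ofMap f γ at hyx'
    constructor
    · rintro ⟨⟨h1, h2⟩, h3⟩
      refine ⟨fun a ha => ?_, fun a b g hab => ?_⟩
      · rcases hcov a with ⟨z, rfl⟩ | ⟨u, rfl⟩
        · exact h1 z ha
        · exact absurd ha (hnz y hyx u)
      · rcases hcov a with ⟨z, rfl⟩ | ⟨u, rfl⟩
        · rcases hcov b with ⟨z', rfl⟩ | ⟨v, rfl⟩
          · exact h2 _ _ _ hab
          · have := (hyx.2 _ _ _ hab).1
            rw [hfz, hfb] at this
            exact absurd this (by simp)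
        · obtain ⟨h4, h5⟩ := hlab y hyx u b g hab
          rcases hcov b with ⟨z', rfl⟩ | ⟨v, rfl⟩
          · rw [hfz] at h4
            exact absurd h4 (by simp)
          -- Comparing set partitions gives a relation in `y'` with some `g'`; since `γ` forces both
          -- `g` and `g'`, they agree.
          · obtain ⟨g', hg'⟩ := @h3 u v ⟨g, hab⟩
            have h6 := (hlab y' hyx' u _ g' hg').2
            rw [h5] at h6
            rwa [mul_right_cancel h6]
    · rintro ⟨h1, h2⟩
      exact ⟨⟨fun z => h1 _, fun z z' g => h2 _ _ _⟩, fun u v ⟨g, hg⟩ => ⟨g, h2 _ _ _ hg⟩⟩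
  · rintro ⟨⟨w, hw⟩, ⟨⟨t, ht⟩, htk⟩⟩
    have htk' : ∀ u v, t u v → cls u = cls v := fun u v h => @htk u v h
    let y := glue hz hb hzb hcov γ w t
    have hy : y ≤ ofMap f γ := by
      constructor
      · rintro a ⟨z, rfl, -⟩
        exact hfz z
      · rintro a b g (⟨z, z', rfl, rfl, h⟩ | ⟨u, v, rfl, rfl, h, h'⟩)
        · exact ⟨by rw [hfz, hfz], Or.inl (hfz _)⟩
        · exact ⟨by rw [hfb, hfb, htk' _ _ h], Or.inr h'⟩
    have hcomap : y.comap iz = w := by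
      ext a b g
      · constructor
        · rintro ⟨z, h, h'⟩
          obtain rfl := hz h
          exact h'
        · exact fun h => ⟨a, rfl, h⟩
      · constructor
        · rintro (⟨z, z', h, h', H⟩ | ⟨u, v, h, -, -, -⟩)
          · obtain rfl := hz h
            obtain rfl := hz h'
            exact H
          · exact absurd h.symm (hzb _ _)
        · exact fun h => Or.inl ⟨a, b, rfl, rfl, h⟩
    have hblock : y.blockSetoid ib = t := by
      ext u v
      constructor
      · rintro ⟨g, (⟨z, z', h, -, -⟩ | ⟨u', v', h, h', H, -⟩)⟩
        · exact absurd h (hzb _ _)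
        · obtain rfl := hb h
          obtain rfl := hb h'
          exact H
      · exact fun h => ⟨γ (ib u) * (γ (ib v))⁻¹, Or.inr ⟨u, v, rfl, rfl, h, by simp⟩⟩
    have hyev : y.Even d χ := by
      intro a ha
      rcases hcov a with ⟨z, rfl⟩ | ⟨u, rfl⟩
      · rw [evenz y hy, hcomap]
        exact hw _ fun h => ha ⟨z, rfl, h⟩
      · rw [evenb y hy, hblock]
        exact ht u
    exact ⟨⟨⟨y, hyev⟩, hy⟩, Prod.ext (Subtype.ext hcomap) (Subtype.ext (Subtype.ext hblock))⟩

end DSetoid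

/-! ### Nontriviality and types. -/

namespace EvenSetoid

variable {α K : Type} {d : ℕ}

/-- An evenly coloured subset of size `d` and its complement form an even partition different from
the one-block partition. -/
lemma nontrivial [Finite α] [Finite K] {c : α → K} (h : EvenlyColouredOn d c Set.univ)
    (hK : Nat.card K ∣ d) (hd : 0 < d) (hcard : d < Nat.card α) :
    Nontrivial (EvenSetoid d c) := by
  obtain ⟨A, -, hA, hAd⟩ := h.exists_subset hK hd (by rw [Set.ncard_univ]; exact hcard.le)
  obtain ⟨a, ha⟩ : A.Nonempty := Set.nonempty_of_ncard_ne_zero (by omega)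
  obtain ⟨b, hb⟩ : ∃ b, b ∉ A := by
    by_contra! hall
    rw [Set.eq_univ_of_forall hall, Set.ncard_univ] at hAd
    omega
  have hA' := h.diff hA (Set.subset_univ _)
  refine ⟨⟨⟨Setoid.ker fun x => x ∈ A, fun x => ?_⟩, ⟨⊤, fun x => ?_⟩, fun heq => hb ?_⟩⟩
  · by_cases hx : x ∈ A
    · convert hA using 1
      ext y
      simp [Setoid.ker_def, hx]
    · convert hA' using 1
      ext y
      simp [Setoid.ker_def, hx]
  · exact (Set.eq_univ_of_forall fun y => (trivial : (⊤ : Setoid α) x y)) ▸ h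
  · have h0 : Setoid.ker (fun x => x ∈ A) = ⊤ := congrArg Subtype.val heq
    have h1 : Setoid.ker (fun x => x ∈ A) a b := by
      rw [h0]
      trivial
    exact (Setoid.ker_def.1 h1).mp ha

/-- The principal ideal of a partition into balanced blocks is a product of posets which depend
only on the sizes of the blocks. -/
theorem exists_type {ι : Type} [Finite α] [Finite ι] [Finite K] [Nonempty K] {c : α → K}
    {f : α → ι} (hf : Function.Surjective f) (h : ∀ a, EvenlyColouredOn d c {b | Setoid.ker f a b})
    (hd : 0 < d) {m n : ℕ} (hmn : m ≤ n) (hα : Nat.card α = d * m) {R : ℕ → Type}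
    [∀ i, PartialOrder (R i)]
    (hR : ∀ (β : Type) [Finite β] (c' : β → K) (i : ℕ), EvenlyColouredOn d c' Set.univ →
      Nat.card β = d * (i + 1) → Nonempty (EvenSetoid d c' ≃o R (i + 1))) :
    ∃ a : Fin n → ℕ, ∑ i : Fin n, ((i : ℕ) + 1) * a i = m ∧ ∑ i, a i = Nat.card ι ∧
      Nonempty (Set.Iic (⟨Setoid.ker f, h⟩ : EvenSetoid d c) ≃o
        ∀ i : Fin n, Fin (a i) → R ((i : ℕ) + 1)) := by
  classical
  have := Fintype.ofFinite ι
  have hbal := balanced_fiber h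
  have hcard : ∀ i, (f ⁻¹' {i}).ncard = Nat.card {a // f a = i} := fun i =>
    (Nat.card_coe_set_eq _).symm
  have hsum : ∑ i, Nat.card {a // f a = i} = d * m := by
    rw [← hα, ← Nat.card_sigma, Nat.card_congr (Equiv.sigmaFiberEquiv f)]
  -- Block sizes are positive multiples of `d`, and index `s` stands for size `d * (s + 1)`. The
  -- index runs to `n` rather than `m` because the type of an element of `S_n` has `n` entries even
  -- when part of the ground set lies in the zero block.
  have hs : ∀ i, ∃ s : Fin n, Nat.card {a // f a = i} = d * ((s : ℕ) + 1) := by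
    intro i
    obtain ⟨t, ht⟩ := (hbal i).1
    rw [hcard] at ht
    have hpos : 0 < Nat.card {a // f a = i} := by
      have : Nonempty {a // f a = i} := 
        let ⟨a, ha⟩ := hf i
        ⟨⟨a, ha⟩⟩
      exact Nat.card_pos
    have htpos : 0 < t := Nat.pos_of_ne_zero (by rintro rfl; omega)
    have hle : Nat.card {a // f a = i} ≤ d * m := hsum ▸
      Finset.single_le_sum (f := fun i => Nat.card {a // f a = i}) (fun _ _ => Nat.zero_le _)
        (Finset.mem_univ i)
    have htm : t ≤ m := Nat.le_of_mul_le_mul_left (ht ▸ hle) hd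
    refine ⟨⟨t - 1, by omega⟩, ?_⟩
    rw [ht]
    congr 1
    simp only
    omega
  choose s hs using hs
  have ha : ∀ i : Fin n, Nat.card {b // s b = i} = (Finset.univ.filter fun b => s b = i).card := by
    intro i
    rw [Nat.card_eq_fintype_card, Fintype.card_subtype]
  refine ⟨fun i => Nat.card {b // s b = i}, ?_, ?_, ?_⟩
  -- After multiplying by `d`, this counts the ground set by blocks, grouped according to size.
  · apply Nat.eq_of_mul_eq_mul_left hd
    rw [← hsum, Finset.sum_congr rfl fun i _ => hs i, ← Finset.mul_sum,
      ← Finset.sum_fiberwise Finset.univ s]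
    congr 1
    refine Finset.sum_congr rfl fun i _ => ?_
    rw [Finset.sum_congr rfl (g := fun _ => (i : ℕ) + 1)]
    · rw [Finset.sum_const, ← ha, smul_eq_mul, mul_comm]
    · intro b hb
      rw [(Finset.mem_filter.1 hb).2]
  · rw [← Nat.card_sigma, Nat.card_congr (Equiv.sigmaFiberEquiv s)]
  · obtain ⟨φ⟩ := nonempty_Iic_ker h
    obtain ⟨ψ⟩ := nonempty_orderIso_pi_fiber (R := fun i : Fin n => R ((i : ℕ) + 1)) s fun i =>
      hR {a // f a = i} (fun a => c a) (s i) (by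
        have := EvenlyColouredOn.image_iff (d := d) (c := c)
          (Subtype.val_injective (p := fun a => f a = i)) (B := Set.univ)
        refine this.1 ?_
        convert hbal i using 1
        ext a
        simp) (hs i)
    exact ⟨φ.trans ψ⟩

end EvenSetoid

namespace DSetoid

variable {α G K : Type*} [Group G] [Group K] {d : ℕ}

/-- With `d = |K| q`, make one nonzero block out of a copy of `K × Fin q`, labelled by lifts along
`χ` of the first coordinate, and put everything else into the zero block. This differs from the
`G`-partition with zero block everything. -/
lemma nontrivial_even [Finite α] [Finite K] {χ : G →* K} (hχ : Function.Surjective χ)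
    (hK : Nat.card K ∣ d) (hd : 0 < d) (hcard : d ≤ Nat.card α) :
    Nontrivial {w : DSetoid α G // w.Even d χ} := by
  classical
  have := Fintype.ofFinite α
  have := Fintype.ofFinite K
  obtain ⟨q, rfl⟩ := hK
  have hq : 0 < q := Nat.pos_of_mul_pos_left hd
  obtain ⟨f⟩ : Nonempty (K × Fin q ↪ α) := by
    apply Function.Embedding.nonempty_of_card_le
    simpa [Nat.card_eq_fintype_card] using hcard
  -- The default label `1` is irrelevant: it is used only on the zero block.
  let γ : α → G := Function.extend f (fun t => Function.surjInv hχ t.1) 1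
  have hγ : (χ ∘ γ) ∘ f = Prod.fst := by
    funext t
    simp [γ, f.injective.extend_apply, Function.surjInv_eq]
  have hbal : EvenlyColouredOn (Nat.card K * q) (χ ∘ γ) (Set.range f) := by
    rw [← Set.image_univ, EvenlyColouredOn.image_iff f.injective, hγ]
    have h1 : ∀ j : K, {t ∈ (Set.univ : Set (K × Fin q)) | t.1 = j}.ncard = q := by
      intro j
      have : {t ∈ (Set.univ : Set (K × Fin q)) | t.1 = j} = (fun t => (j, t)) '' Set.univ := by
        ext ⟨j', t⟩
        simp [eq_comm]
      rw [this, Set.ncard_image_of_injective _ (Prod.mk_right_injective j), Set.ncard_univ]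
      simp
    exact ⟨by rw [Set.ncard_eq_card_mul h1], fun j j' => by rw [h1, h1]⟩
  let x : DSetoid α G := ofMap (fun a => if a ∈ Set.range f then some () else none) γ
  let y : DSetoid α G := ofMap (fun _ => (none : Option Unit)) γ
  refine ⟨⟨⟨x, even_ofMap.2 fun i => ?_⟩, ⟨y, even_ofMap.2 fun i => ?_⟩, fun heq => ?_⟩⟩
  · convert hbal
    ext a
    simp
  · convert EvenlyColouredOn.empty
    ext a
    simp
  · have h1 : x.Z = y.Z := congrArg (fun w => w.1.Z) heq
    have h2 : x.Z (f (1, ⟨0, hq⟩)) := by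
      rw [h1]
      exact ofMap_Z.2 rfl
    simp [x] at h2

end DSetoid

/-! ### Even colouring of prepartitions and its persistence under merging. -/

namespace GPrepartition

variable {G K : Type*} [Group G] [Group K] {n d : ℕ}

lemma even_toDSetoid {χ : G →* K} (p : GPrepartition G n) :
    p.toDSetoid.Even d χ ↔ ∀ B ∈ p.π.parts, EvenlyColouredOn d (χ ∘ p.γ) ↑B := by
  rw [toDSetoid, DSetoid.even_ofMap]
  have h1 : ∀ i, {a | p.blockMap a = some i} = ((p.π.parts.equivFin.symm i).1 : Set (Fin n)) := by
    intro i
    ext a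
    exact p.blockMap_eq_some
  simp only [h1]
  constructor
  · intro h B hB
    simpa using h (p.π.parts.equivFin ⟨B, hB⟩)
  · exact fun h i => h _ (p.π.parts.equivFin.symm i).2

lemma SameLabels.evenlyColouredOn {χ : G →* K} {B : Finset (Fin n)} {γ γ' : Fin n → G}
    (h : SameLabels B γ γ') (hB : EvenlyColouredOn d (χ ∘ γ) ↑B) :
    EvenlyColouredOn d (χ ∘ γ') ↑B := by
  obtain ⟨g, hg⟩ := h
  exact hB.of_shift (χ g) fun i hi => by simp [hg i hi]

/-- Absorbing a block into the zero block only drops a condition. In a merge of `B` and `C`,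
multiplying the labels on `C` by `g` permutes its colours, and a disjoint union of even sets is
even. -/
lemma Merge.even {χ : G →* K} {p q : GPrepartition G n} (h : p.Merge q)
    (hp : p.toDSetoid.Even d χ) : q.toDSetoid.Even d χ := by
  rw [even_toDSetoid] at *
  rcases h with ⟨B, hB, -, hparts, hl⟩ | ⟨B, hB, C, hC, hBC, -, hparts, hl, g, hg⟩
  · intro D hD
    rw [hparts] at hD
    exact (hl D hD).evenlyColouredOn (hp D (Finset.mem_of_mem_erase hD))
  · intro D hD
    rw [hparts, Finset.mem_insert] at hD
    rcases hD with rfl | hD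
    · apply hg.evenlyColouredOn
      rw [Finset.coe_union]
      have hdisj : Disjoint B C := p.π.disjoint hB hC hBC
      refine EvenlyColouredOn.union ?_ ?_ (Finset.disjoint_coe.2 hdisj)
      · refine (hp B hB).of_shift 1 fun i hi => ?_
        simp [Finset.disjoint_left.1 hdisj hi]
      · refine (hp C hC).of_shift (χ g) fun i hi => ?_
        simp [Finset.mem_coe.1 hi]
    · exact (hl D hD).evenlyColouredOn
        (hp D (Finset.mem_of_mem_erase (Finset.mem_of_mem_erase hD)))

end GPrepartition

/-- The even elements form an upper set, so upper intervals and covering merges in `Q_N(r,d,k)` away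
from its minimum are those of the Dowling lattice. -/
lemma DowlingLattice.even_mono {G K : Type*} [Group G] [Group K] {n d : ℕ} {χ : G →* K}
    {x y : DowlingLattice G n} (h : x ≤ y) (hx : (toDSetoid G n x).Even d χ) :
    (toDSetoid G n y).Even d χ := by
  rw [le_iff_merges] at h
  induction h with
  | refl => exact hx
  | tail _ h ih =>
    obtain ⟨p, q, rfl, rfl, h⟩ := h
    rw [toDSetoid_mk] at *
    exact h.even ih

/-- Reduction modulo `k` of the labels in `μ_r`. -/
def colourHom {r k : ℕ} (hkr : k ∣ r) : CyclicGroup r →* Multiplicative (ZMod k) :=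
  (ZMod.castHom hkr (ZMod k)).toAddMonoidHom.toMultiplicative

lemma colourHom_apply {r k : ℕ} (hkr : k ∣ r) (g : CyclicGroup r) :
    colourHom hkr g = Multiplicative.ofAdd (g.toAdd.cast : ZMod k) := rfl

lemma colourHom_surjective {r k : ℕ} (hkr : k ∣ r) : Function.Surjective (colourHom hkr) :=
  ZMod.ringHom_surjective (ZMod.castHom hkr (ZMod k))

lemma GPrepartition.isEvenlyColoured_iff {r n d k : ℕ} (hkr : k ∣ r)
    (p : GPrepartition (CyclicGroup r) n) :
    p.IsEvenlyColoured d k ↔ p.toDSetoid.Even d (colourHom hkr) := by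
  rw [even_toDSetoid]
  refine forall₂_congr fun B hB => ?_
  have h : ∀ j : ZMod k, {b ∈ (B : Set (Fin n)) | (colourHom hkr ∘ p.γ) b = .ofAdd j}.ncard =
      (B.filter fun a => ((p.γ a).toAdd.cast : ZMod k) = j).card := by
    intro j
    rw [← Set.ncard_coe_finset]
    congr 1
    ext b
    simp [colourHom_apply]
  rw [EvenlyColouredOn, Set.ncard_coe_finset]
  exact and_congr_right fun _ =>
    ⟨fun H j j' => (h j.toAdd).trans ((H _ _).trans (h j'.toAdd).symm),
      fun H j j' => (h j).symm.trans ((H _ _).trans (h j'))⟩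

lemma mem_evenlyColoured_iff {r N d k : ℕ} (hkr : k ∣ r) (x : DowlingLattice (CyclicGroup r) N) :
    x ∈ evenlyColoured N r d k ↔
      (DowlingLattice.toDSetoid _ N x).Even d (colourHom hkr) := by
  induction x using Quotient.inductionOn with | _ p => ?_
  exact (mk_mem_evenlyColoured hkr p).trans (by
    rw [p.isEvenlyColoured_iff hkr, ← DowlingLattice.toDSetoid_mk]; rfl)

/-! ### `Q_N(r,d,k)` without its minimum. -/

section Underlying

variable {r N d k : ℕ}

/-- The element of `Q_N(r)` underlying an element of `Q_N(r, d, k)` other than the minimum. -/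
def EvenDowling.toDowling (x : {x : EvenDowling N r d k // x ≠ ⊥}) :
    DowlingLattice (CyclicGroup r) N := (x.1.unbot x.2).1

lemma EvenDowling.toDowling_le {x y : {x : EvenDowling N r d k // x ≠ ⊥}} :
    toDowling x ≤ toDowling y ↔ x ≤ y :=
  WithBot.unbot_le_unbot_iff x.2 y.2

lemma EvenDowling.toDowling_mem (x : {x : EvenDowling N r d k // x ≠ ⊥}) :
    toDowling x ∈ evenlyColoured N r d k := (x.1.unbot x.2).2

lemma EvenDowling.exists_toDowling_eq {x : DowlingLattice (CyclicGroup r) N}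
    (hx : x ∈ evenlyColoured N r d k) :
    ∃ y : {x : EvenDowling N r d k // x ≠ ⊥}, toDowling y = x :=
  ⟨⟨((⟨x, hx⟩ : evenlyColoured N r d k) : WithBot _), WithBot.coe_ne_bot⟩, rfl⟩

lemma EvenDowling.exists_orderIso (N d : ℕ) (hkr : k ∣ r) :
    ∃ φ : {x : EvenDowling N r d k // x ≠ ⊥} ≃o
      {y : DSetoid (Fin N) (CyclicGroup r) // y.Even d (colourHom hkr)},
      ∀ x, (φ x).1 = DowlingLattice.toDSetoid _ N (toDowling x) := by
  have key := exists_orderIso_of_surjective (fun x : {x : EvenDowling N r d k // x ≠ ⊥} =>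
    (⟨DowlingLattice.toDSetoid _ N (toDowling x),
      (mem_evenlyColoured_iff hkr _).1 (toDowling_mem x)⟩ :
      {y : DSetoid (Fin N) (CyclicGroup r) // y.Even d (colourHom hkr)})) ?_ ?_
  · obtain ⟨φ, hφ⟩ := key
    exact ⟨φ, fun x => by rw [hφ]⟩
  · intro x y
    rw [← toDowling_le, ← (DowlingLattice.toDSetoid _ N).le_iff_le]
    rfl
  · rintro ⟨y, hy⟩
    obtain ⟨z, hz⟩ := (DowlingLattice.toDSetoid _ N).surjective y
    obtain ⟨x, hx⟩ := exists_toDowling_eq ((mem_evenlyColoured_iff (d := d) hkr z).2 (hz ▸ hy))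
    exact ⟨x, Subtype.ext (by simp only [hx, hz])⟩

lemma EvenDowling.nonempty_Ici (hkr : k ∣ r) (x : {x : EvenDowling N r d k // x ≠ ⊥}) :
    Nonempty (Set.Ici x ≃o DowlingLattice (CyclicGroup r) (toDowling x).numBlocks) := by
  obtain ⟨φ⟩ := (toDowling x).nonempty_Ici
  refine Nonempty.map (fun ψ => OrderIso.trans ψ φ) ?_
  refine nonempty_orderIso_of_surjective (fun y => ⟨toDowling y.1, toDowling_le.2 y.2⟩)
    (fun y z => toDowling_le) ?_
  rintro ⟨y, hy⟩
  obtain ⟨z, rfl⟩ := exists_toDowling_eq (d := d) (k := k) ((mem_evenlyColoured_iff hkr y).2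
    (DowlingLattice.even_mono hy ((mem_evenlyColoured_iff hkr _).1 (toDowling_mem x))))
  exact ⟨⟨z, toDowling_le.1 hy⟩, rfl⟩

lemma EvenDowling.exists_step (hkr : k ∣ r) {x y : {x : EvenDowling N r d k // x ≠ ⊥}}
    (h : x < y) : ∃ z, x < z ∧ z ≤ y ∧
      (toDowling z).numBlocks + 1 = (toDowling x).numBlocks := by
  have h' : toDowling x < toDowling y :=
    lt_of_le_not_ge (toDowling_le.2 h.le) fun h' => h.not_ge (toDowling_le.1 h')
  obtain ⟨z, h1, h2, h3⟩ := DowlingLattice.exists_numBlocks_add_one h'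
  obtain ⟨z, rfl⟩ := exists_toDowling_eq (d := d) (k := k) ((mem_evenlyColoured_iff hkr z).2
    (DowlingLattice.even_mono h1.le ((mem_evenlyColoured_iff hkr _).1 (toDowling_mem x))))
  exact ⟨z, lt_of_le_not_ge (toDowling_le.1 h1.le) fun h' => h1.not_ge (toDowling_le.2 h'),
    toDowling_le.1 h2, h3⟩

instance [NeZero r] : Finite {x : EvenDowling N r d k // x ≠ ⊥} :=
  have : Finite (CyclicGroup r) := inferInstanceAs (Finite (ZMod r))
  Finite.of_injective (EvenDowling.toDowling (N := N) (r := r) (d := d) (k := k))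
    fun _ _ h => le_antisymm (EvenDowling.toDowling_le.1 h.le) (EvenDowling.toDowling_le.1 h.ge)

end Underlying

/-! ### `R'_n` as a poset of even set partitions. -/

section RPoset

variable {r d k n : ℕ} {hkr : k ∣ r} {hkd : k ∣ d}

/-- `R'_n` as a subset of `S_n`. -/
def RPoset.toNeBot (x : RPoset hkr hkd n) : {x : EvenDowling (d * n) r d k // x ≠ ⊥} := ⟨x.1, x.2.1⟩

lemma RPoset.toDowling_le_mk_cPre (x : RPoset hkr hkd n) :
    EvenDowling.toDowling x.toNeBot ≤ .mk (cPre r d k n) :=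
  EvenDowling.toDowling_le (x := x.toNeBot) (y := ⟨cElement hkr hkd n, WithBot.coe_ne_bot⟩).2 x.2.2

/-- The zero block of `c_n` is empty, so its factor in `DSetoid.exists_Iic_ofMap` is a point; and
`c_n` has at most one block, so the remaining factor is the whole poset of even set partitions. -/
lemma RPoset.exists_orderIso (n : ℕ) (hkr : k ∣ r) (hkd : k ∣ d) :
    ∃ Φ : RPoset hkr hkd n ≃o EvenSetoid d (colourHom hkr ∘ (cPre r d k n).γ),
      ∀ x, (Φ x).1 = (DowlingLattice.toDSetoid _ _ (EvenDowling.toDowling x.toNeBot)).blockSetoid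
        id := by
  let p := cPre r d k n
  have hp : p.toDSetoid.Even d (colourHom hkr) :=
    (p.isEvenlyColoured_iff hkr).1 (cPre_isEvenlyColoured hkr hkd n)
  have hsome : ∀ a, ∃ i, p.blockMap a = some i := fun a => Option.ne_none_iff_exists'.1 fun h =>
    Finset.notMem_empty a (p.blockMap_eq_none.1 h)
  choose cls hcls using hsome
  have htop : ∀ a b, cls a = cls b := by
    intro a b
    have hsub : ∀ B ∈ p.π.parts, B = p.zeroᶜ := fun B hB =>
      Finset.mem_singleton.1 (Finpartition.parts_top_subset _ hB)
    apply p.π.parts.equivFin.symm.injective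
    exact Subtype.ext ((hsub _ (Subtype.prop _)).trans (hsub _ (Subtype.prop _)).symm)
  obtain ⟨φ, hφ⟩ := EvenDowling.exists_orderIso (d * n) d hkr
  obtain ⟨hs, Ψ, hΨ⟩ := DSetoid.exists_Iic_ofMap (ζ := Empty) (ib := id) (iz := Empty.elim)
    (fun z => z.elim) Function.injective_id (fun z => z.elim) hcls (fun a => Or.inr ⟨a, rfl⟩) hp
  let c : {x : EvenDowling (d * n) r d k // x ≠ ⊥} := ⟨cElement hkr hkd n, WithBot.coe_ne_bot⟩
  have hc : φ c = ⟨p.toDSetoid, hp⟩ := Subtype.ext ((hφ c).trans (DowlingLattice.toDSetoid_mk p))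
  let θ := (OrderIso.IicCongr φ hc).trans Ψ
  have key := exists_orderIso_of_surjective (Y := EvenSetoid d (colourHom hkr ∘ p.γ))
    (fun x : RPoset hkr hkd n => (θ ⟨x.toNeBot, x.2.2⟩).2.1) ?_ ?_
  · obtain ⟨Φ, hΦ⟩ := key
    refine ⟨Φ, fun x => ?_⟩
    rw [hΦ]
    refine (hΨ _).trans ?_
    congr 1
    exact hφ _
  · intro x y
    have h1 : (θ ⟨x.toNeBot, x.2.2⟩) ≤ (θ ⟨y.toNeBot, y.2.2⟩) ↔ x ≤ y := θ.le_iff_le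
    exact Iff.trans ⟨fun h => ⟨⟨fun z => z.elim, fun z => z.elim⟩, h⟩, fun h => h.2⟩ h1
  · intro s
    let w : {w : DSetoid Empty (CyclicGroup r) // w.Even d (colourHom hkr)} :=
      ⟨.ofMap (Empty.elim : Empty → Option Unit) Empty.elim, fun z => z.elim⟩
    obtain ⟨⟨x, hx⟩, hxs⟩ := θ.surjective (w, ⟨s, fun a b _ => htop a b⟩)
    exact ⟨⟨x.1, x.2, hx⟩, congrArg (fun t => t.2.1) hxs⟩

end RPoset

/-! ### Types of elements: axioms (E3) and (D3). -/

section Lower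

variable {r d k : ℕ}

lemma evenlyColouredOn_cPre (hkr : k ∣ r) (hkd : k ∣ d) (n : ℕ) :
    EvenlyColouredOn d (colourHom hkr ∘ (cPre r d k n).γ) Set.univ := by
  have h := (cPre r d k n).even_toDSetoid.1
    (((cPre r d k n).isEvenlyColoured_iff hkr).1 (cPre_isEvenlyColoured hkr hkd n))
  -- When `dn = 0` the element `c_n` has no block from which to read off the balance.
  rcases isEmpty_or_nonempty (Fin (d * n)) with he | ⟨⟨a⟩⟩
  · rw [Set.univ_eq_empty_iff.2 he]
    exact EvenlyColouredOn.empty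
  · obtain ⟨B, hB, -⟩ := (cPre r d k n).π.exists_mem (a := a)
      (Finset.mem_compl.2 (Finset.notMem_empty a))
    have := h B hB
    rw [Finset.mem_singleton.1 (Finpartition.parts_top_subset _ hB)] at this
    simpa [cPre] using this

lemma nonempty_orderIso_RPoset [NeZero k] (hkr : k ∣ r) (hkd : k ∣ d) {β : Type} [Finite β]
    {c : β → Multiplicative (ZMod k)} {n : ℕ} (hc : EvenlyColouredOn d c Set.univ)
    (hcard : Nat.card β = d * n) : Nonempty (EvenSetoid d c ≃o RPoset hkr hkd n) := by
  have : Finite (Multiplicative (ZMod k)) := inferInstanceAs (Finite (ZMod k))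
  obtain ⟨Φ, -⟩ := RPoset.exists_orderIso n hkr hkd
  obtain ⟨φ⟩ := EvenSetoid.nonempty_congr_of_card hc (evenlyColouredOn_cPre hkr hkd n)
    (by simpa using hcard)
  exact ⟨φ.trans Φ.symm⟩

/-- The number of blocks of an element of `R'_n`. -/
def RPoset.numBlocks {hkr : k ∣ r} {hkd : k ∣ d} {n : ℕ} (x : RPoset hkr hkd n) : ℕ :=
  (EvenDowling.toDowling x.toNeBot).numBlocks

/-- An element below `c_n` has empty zero block, so its block map is total and presents it as a
kernel. Indexing the blocks by `Fin x.numBlocks` ties both intervals at `x` to the rank. -/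
lemma RPoset.exists_ker (hkr : k ∣ r) (hkd : k ∣ d) (n : ℕ) :
    ∃ Φ : RPoset hkr hkd n ≃o EvenSetoid d (colourHom hkr ∘ (cPre r d k n).γ),
      ∀ x, ∃ f : Fin (d * n) → Fin x.numBlocks, Function.Surjective f ∧
        (Φ x).1 = Setoid.ker f := by
  obtain ⟨Φ, hΦ⟩ := RPoset.exists_orderIso n hkr hkd
  refine ⟨Φ, fun x => ?_⟩
  rw [hΦ]
  have hle := x.toDowling_le_mk_cPre
  unfold RPoset.numBlocks
  generalize EvenDowling.toDowling x.toNeBot = y at hle ⊢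
  induction y using Quotient.inductionOn with | _ p => ?_
  change ∃ f : Fin (d * n) → Fin p.π.parts.card, _
  have hzero : p.zero ⊆ ∅ := (show p.Refines (cPre r d k n) from hle).1
  have hsome : ∀ a, ∃ i, p.blockMap a = some i := fun a => Option.ne_none_iff_exists'.1 fun h =>
    Finset.notMem_empty a (hzero (p.blockMap_eq_none.1 h))
  choose f hf using hsome
  refine ⟨f, fun i => ?_, ?_⟩
  · obtain ⟨a, ha⟩ := p.exists_blockMap_eq_some i
    exact ⟨a, Option.some.inj ((hf a).symm.trans ha)⟩
  · have h1 : DowlingLattice.toDSetoid _ _ ⟦p⟧ = p.toDSetoid := DowlingLattice.toDSetoid_mk p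
    rw [h1]
    ext a b
    simp only [DSetoid.blockSetoid_def, GPrepartition.toDSetoid, DSetoid.ofMap_R, id, hf,
      Option.some.injEq, reduceCtorEq, false_or]
    exact ⟨fun ⟨_, h, _⟩ => h, fun h => ⟨p.γ a * (p.γ b)⁻¹, h, by simp⟩⟩

lemma RPoset.nonempty_Ici {hkr : k ∣ r} {hkd : k ∣ d} {n : ℕ} (x : RPoset hkr hkd n) :
    Nonempty (Set.Ici x ≃o Setoid (Fin x.numBlocks)) := by
  obtain ⟨Φ, hΦ⟩ := RPoset.exists_ker hkr hkd n
  obtain ⟨f, hf, hx⟩ := hΦ x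
  have h := (Φ x).2
  rw [hx] at h
  obtain ⟨φ⟩ := EvenSetoid.nonempty_Ici_ker hf h
  exact ⟨(Φ.IciCongr (Subtype.ext hx)).trans φ⟩

lemma RPoset.exists_type [NeZero k] {hkr : k ∣ r} {hkd : k ∣ d} (hd : 0 < d) {n : ℕ}
    (x : RPoset hkr hkd n) :
    ∃ a : Fin n → ℕ, ∑ i : Fin n, ((i : ℕ) + 1) * a i = n ∧ ∑ i, a i = x.numBlocks ∧
      Nonempty (Set.Iic x ≃o ∀ i : Fin n, Fin (a i) → RPoset hkr hkd ((i : ℕ) + 1)) := by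
  have : Finite (Multiplicative (ZMod k)) := inferInstanceAs (Finite (ZMod k))
  obtain ⟨Φ, hΦ⟩ := RPoset.exists_ker hkr hkd n
  obtain ⟨f, hf, hx⟩ := hΦ x
  have h := (Φ x).2
  rw [hx] at h
  obtain ⟨a, h1, h2, ⟨φ⟩⟩ := EvenSetoid.exists_type hf h hd (le_refl n) (by simp)
    (R := fun n => RPoset hkr hkd n) fun β _ c i hc hcard => nonempty_orderIso_RPoset hkr hkd hc hcard
  exact ⟨a, h1, by simpa using h2, ⟨(Φ.IicCongr (Subtype.ext hx)).trans φ⟩⟩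

/-- The nonzero blocks cover `d * m` elements, and `e < d` leaves a zero block of size `d * b + e`
with `b + m = n`; its even `G`-partitions form `S_b`, while the nonzero blocks contribute the
factors `R'_i`. -/
lemma SPoset.exists_type [NeZero k] (hkr : k ∣ r) (hkd : k ∣ d) {e n : ℕ} (he : e < d)
    (x : SPoset r d e k n) :
    ∃ (b : ℕ) (a : Fin n → ℕ), b + ∑ i : Fin n, ((i : ℕ) + 1) * a i = n ∧
      ∑ i, a i = (EvenDowling.toDowling x).numBlocks ∧
      Nonempty (Set.Iic x ≃o SPoset r d e k b ×
        ∀ i : Fin n, Fin (a i) → RPoset hkr hkd ((i : ℕ) + 1)) := by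
  have : Finite (Multiplicative (ZMod k)) := inferInstanceAs (Finite (ZMod k))
  have hd : 0 < d := by omega
  obtain ⟨Φ, hΦ⟩ := EvenDowling.exists_orderIso (k := k) (d * n + e) d hkr
  have hx := hΦ x
  have heven := (Φ x).2
  obtain ⟨p, hp⟩ := Quotient.exists_rep (EvenDowling.toDowling x)
  rw [← hp]
  change ∃ (b : ℕ) (a : Fin n → ℕ), _ ∧ ∑ i, a i = p.π.parts.card ∧ _
  have hxp : (Φ x).1 = p.toDSetoid := by
    rw [hx, ← hp]
    exact DowlingLattice.toDSetoid_mk p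
  rw [hxp] at heven
  have hsome : ∀ u : {u // u ∉ p.zero}, ∃ i, p.blockMap u = some i := fun u =>
    Option.ne_none_iff_exists'.1 fun h => u.2 (p.blockMap_eq_none.1 h)
  choose cls hcls using hsome
  have hsurj : Function.Surjective cls := by
    intro i
    obtain ⟨a, ha⟩ := p.exists_blockMap_eq_some i
    have ha' : a ∉ p.zero := fun h => by
      rw [p.blockMap_eq_none.2 h] at ha
      simp at ha
    exact ⟨⟨a, ha'⟩, Option.some.inj ((hcls ⟨a, ha'⟩).symm.trans ha)⟩
  have hdvd : d ∣ Nat.card {u // u ∉ p.zero} := by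
    rw [← Nat.card_congr (Equiv.sigmaFiberEquiv cls), Nat.card_sigma]
    refine Finset.dvd_sum fun i _ => ?_
    have h1 := (DSetoid.even_ofMap.1 heven i).1
    rw [← Nat.card_coe_set_eq] at h1
    have hnz : ∀ a : {a | p.blockMap a = some i}, a.1 ∉ p.zero := fun a h => by
      have h2 : p.blockMap a.1 = some i := a.2
      rw [p.blockMap_eq_none.2 h] at h2
      simp at h2
    let ε : {u : {u // u ∉ p.zero} // cls u = i} ≃ {a | p.blockMap a = some i} :=
      { toFun := fun u => ⟨u.1.1, (hcls u.1).trans (by rw [u.2])⟩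
        invFun := fun a => ⟨⟨a.1, hnz a⟩, Option.some.inj ((hcls _).symm.trans a.2)⟩
        left_inv := fun _ => rfl
        right_inv := fun _ => rfl }
    rwa [Nat.card_congr ε]
  obtain ⟨m, hm⟩ := hdvd
  have hcard : p.zero.card + d * m = d * n + e := by
    rw [← hm, Nat.card_eq_fintype_card, Fintype.card_subtype_compl, Fintype.card_fin,
      Fintype.card_coe]
    have := p.zero.card_le_univ
    rw [Fintype.card_fin] at this
    omega
  have hmn : m ≤ n := by
    -- This is where `e < d` enters: `d * m ≤ d * n + e < d * (n + 1)`.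
    have : d * m < d * (n + 1) := by rw [mul_add]; omega
    have := Nat.lt_of_mul_lt_mul_left this
    omega
  obtain ⟨b, rfl⟩ := Nat.exists_eq_add_of_le' hmn
  have hzcard : p.zero.card = d * b + e := by
    have := mul_add d b m
    omega
  let ε := p.zero.equivFinOfCardEq hzcard
  obtain ⟨hs, Ψ, -⟩ := DSetoid.exists_Iic_ofMap (iz := fun z => (ε.symm z).1)
    (ib := fun u : {u // u ∉ p.zero} => u.1)
    (fun z z' h => ε.symm.injective (Subtype.ext h)) Subtype.val_injective
    (fun z => p.blockMap_eq_none.2 (ε.symm z).2) hcls (fun a => by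
      by_cases ha : a ∈ p.zero
      · exact Or.inl ⟨ε ⟨a, ha⟩, by simp⟩
      · exact Or.inr ⟨⟨a, ha⟩, rfl⟩) heven
  obtain ⟨a, h1, h2, ⟨φ⟩⟩ := EvenSetoid.exists_type hsurj hs hd hmn hm
    (R := fun n => RPoset hkr hkd n) fun β _ c i hc hcard => nonempty_orderIso_RPoset hkr hkd hc hcard
  obtain ⟨φS, -⟩ := EvenDowling.exists_orderIso (k := k) (d * b + e) d hkr
  exact ⟨b, a, by omega, by simpa using h2,
    ⟨((Φ.IicCongr (Subtype.ext hxp)).trans Ψ).trans (φS.symm.prodCongr φ)⟩⟩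

end Lower

lemma sum_type_le {n : ℕ} (a : Fin n → ℕ) : ∑ i, a i ≤ ∑ i : Fin n, ((i : ℕ) + 1) * a i :=
  Finset.sum_le_sum fun _ _ => Nat.le_mul_of_pos_left _ (Nat.succ_pos _)

/-- A product that is a point has no factor `R i` with `i ≥ 2`, so both sums reduce to the number of
factors `R 1`. -/
lemma sum_type_eq {n : ℕ} {a : Fin n → ℕ} {R : ℕ → Type*} [∀ i, Nonempty (R i)]
    (hR : ∀ i, 2 ≤ i → Nontrivial (R i))
    (h : Subsingleton (∀ i : Fin n, Fin (a i) → R ((i : ℕ) + 1))) :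
    ∑ i : Fin n, ((i : ℕ) + 1) * a i = ∑ i, a i := by
  refine Finset.sum_congr rfl fun i _ => ?_
  rcases Nat.eq_zero_or_pos (a i) with h0 | h0
  · simp [h0]
  rcases Nat.eq_zero_or_pos (i : ℕ) with hi | hi
  · simp [hi]
  · have := hR ((i : ℕ) + 1) (by omega)
    have : Nonempty (Fin (a i)) := ⟨⟨0, h0⟩⟩
    exact absurd h (not_subsingleton_iff_nontrivial.2 (Pi.nontrivial_at i))

/-! ### The rank function and verification of the axioms. -/

section Main

variable {r d k : ℕ} {hkr : k ∣ r} {hkd : k ∣ d}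

instance (n : ℕ) : Nonempty (RPoset hkr hkd n) :=
  ⟨⟨cElement hkr hkd n, WithBot.coe_ne_bot, le_rfl⟩⟩

lemma RPoset.nontrivial [NeZero k] (hd : 0 < d) {n : ℕ} (hn : 2 ≤ n) :
    Nontrivial (RPoset hkr hkd n) := by
  have : Finite (Multiplicative (ZMod k)) := inferInstanceAs (Finite (ZMod k))
  obtain ⟨Φ, -⟩ := RPoset.exists_orderIso n hkr hkd
  have := EvenSetoid.nontrivial (evenlyColouredOn_cPre hkr hkd n)
    ((Nat.card_zmod k).symm ▸ hkd :) hd (by simpa using (by nlinarith : d < d * n))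
  exact Φ.toEquiv.nontrivial

lemma SPoset.nontrivial [NeZero k] (hkr : k ∣ r) (hkd : k ∣ d) (hd : 0 < d) {e n : ℕ}
    (hn : 1 ≤ n) : Nontrivial (SPoset r d e k n) := by
  have : Finite (Multiplicative (ZMod k)) := inferInstanceAs (Finite (ZMod k))
  obtain ⟨Φ, -⟩ := EvenDowling.exists_orderIso (k := k) (d * n + e) d hkr
  have := DSetoid.nontrivial_even (α := Fin (d * n + e)) (colourHom_surjective hkr)
    ((Nat.card_zmod k).symm ▸ hkd :) hd (by simpa using (by nlinarith : d ≤ d * n + e))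
  exact Φ.toEquiv.nontrivial

lemma SPoset.exists_top (hkr : k ∣ r) (e n : ℕ) :
    ∃ t : SPoset r d e k n, (∀ x, x ≤ t) ∧ (EvenDowling.toDowling t).numBlocks = 0 := by
  let p : GPrepartition (CyclicGroup r) (d * n + e) := ⟨Finset.univ, ⊥, 1⟩
  have hparts : p.π.parts = ∅ := by
    rw [Finset.eq_empty_iff_forall_notMem]
    intro B hB
    obtain ⟨a, ha⟩ := p.π.nonempty_of_mem_parts hB
    simpa [p] using p.π.le hB ha
  have heven : p.IsEvenlyColoured d k := fun B hB => by simp [hparts] at hB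
  obtain ⟨t, ht⟩ := EvenDowling.exists_toDowling_eq ((mk_mem_evenlyColoured hkr p).2 heven)
  refine ⟨t, fun x => ?_, ?_⟩
  · rw [← EvenDowling.toDowling_le, ht]
    induction EvenDowling.toDowling x using Quotient.inductionOn with | _ q => ?_
    exact ⟨Finset.subset_univ _, fun B _ => Or.inl (Finset.subset_univ _)⟩
  · rw [ht, DowlingLattice.numBlocks_mk, hparts, Finset.card_empty]

lemma RPoset.exists_top (hd : 0 < d) {n : ℕ} (hn : 1 ≤ n) :
    ∃ t : RPoset hkr hkd n, (∀ x, x ≤ t) ∧ t.numBlocks = 1 := by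
  refine ⟨⟨cElement hkr hkd n, WithBot.coe_ne_bot, le_rfl⟩, fun x => x.2.2, ?_⟩
  change (cPre r d k n).π.parts.card = 1
  have h1 := Finset.card_le_card (Finpartition.parts_top_subset (∅ : Finset (Fin (d * n)))ᶜ)
  obtain ⟨B, hB, -⟩ := (cPre r d k n).π.exists_mem (a := ⟨0, Nat.mul_pos hd hn⟩)
    (Finset.mem_compl.2 (Finset.notMem_empty _))
  have h2 : 0 < (cPre r d k n).π.parts.card := Finset.card_pos.2 ⟨B, hB⟩
  exact le_antisymm h1 h2

lemma RPoset.numBlocks_le [NeZero k] (hd : 0 < d) {n : ℕ} (x : RPoset hkr hkd n) :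
    x.numBlocks ≤ n := by
  obtain ⟨a, h1, h2, -⟩ := x.exists_type hd
  have := sum_type_le a
  omega

lemma RPoset.one_le_numBlocks (hd : 0 < d) {n : ℕ} (hn : 1 ≤ n) (x : RPoset hkr hkd n) :
    1 ≤ x.numBlocks := by
  obtain ⟨t, ht, ht'⟩ := RPoset.exists_top (hkr := hkr) (hkd := hkd) hd hn
  exact ht' ▸ DowlingLattice.numBlocks_antitone
    ((EvenDowling.toDowling_le (x := x.toNeBot) (y := t.toNeBot)).2 (ht x))

/-- The lower ideal of a minimal element is a point, which by its type forces all blocks to have the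
least size `d`. -/
lemma RPoset.numBlocks_of_isMin [NeZero k] (hd : 0 < d) {n : ℕ} {x : RPoset hkr hkd n}
    (hx : IsMin x) : x.numBlocks = n := by
  obtain ⟨a, h1, h2, ⟨φ⟩⟩ := x.exists_type hd
  have := hx.subsingleton_Iic
  have := sum_type_eq (R := fun i => RPoset hkr hkd i) (fun i hi => RPoset.nontrivial hd hi)
    φ.symm.toEquiv.subsingleton
  omega

lemma RPoset.exists_step {n : ℕ} {x y : RPoset hkr hkd n} (h : x < y) :
    ∃ z, x < z ∧ z ≤ y ∧ z.numBlocks + 1 = x.numBlocks := by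
  obtain ⟨z, h1, h2, h3⟩ := EvenDowling.exists_step hkr
    (show x.toNeBot < y.toNeBot from h)
  exact ⟨⟨z.1, z.2, le_trans (show z.1 ≤ y.1 from h2) y.2.2⟩, h1, h2, h3⟩

lemma SPoset.numBlocks_le [NeZero k] (hkr : k ∣ r) (hkd : k ∣ d) {e n : ℕ} (he : e < d)
    (x : SPoset r d e k n) : (EvenDowling.toDowling x).numBlocks ≤ n := by
  obtain ⟨b, a, h1, h2, -⟩ := SPoset.exists_type hkr hkd he x
  have := sum_type_le a
  omega

/-- As for `R'_n`, but the factor `S_b` must be a point as well, which forces `b = 0`. -/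
lemma SPoset.numBlocks_of_isMin [NeZero k] (hkr : k ∣ r) (hkd : k ∣ d) {e n : ℕ} (he : e < d)
    {x : SPoset r d e k n} (hx : IsMin x) : (EvenDowling.toDowling x).numBlocks = n := by
  obtain ⟨b, a, h1, h2, ⟨φ⟩⟩ := SPoset.exists_type hkr hkd he x
  have := hx.subsingleton_Iic
  have hsub := φ.symm.toEquiv.subsingleton
  -- Only a point of `S_b` is needed, to pass from the trivial product to a trivial second factor.
  obtain ⟨t, -⟩ := SPoset.exists_top (d := d) hkr e b
  have h3 := sum_type_eq (R := fun i => RPoset hkr hkd i)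
    (fun i hi => RPoset.nontrivial (by omega) hi)
    ⟨fun u v => congrArg Prod.snd (hsub.elim (t, u) (t, v))⟩
  have h4 : b = 0 := by
    by_contra hb
    obtain ⟨u, v, huv⟩ := SPoset.nontrivial hkr hkd (by omega : 0 < d) (e := e)
      (Nat.one_le_iff_ne_zero.2 hb)
    exact huv (congrArg Prod.fst (hsub.elim (u, fun _ _ => Classical.arbitrary _)
      (v, fun _ _ => Classical.arbitrary _)))
  omega

theorem isExponentialStructure_RPoset [NeZero r] [NeZero k] (hd : 0 < d) :
    IsExponentialStructure (fun n => RPoset hkr hkd n) := by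
  -- The rank is `n - x.numBlocks`; truncation of the subtraction is harmless because there are at
  -- most `n` blocks.
  have hstep : ∀ n, ∀ x y : RPoset hkr hkd n, x < y →
      ∃ z, x < z ∧ z ≤ y ∧ n - z.numBlocks = n - x.numBlocks + 1 := by
    intro n x y h
    obtain ⟨z, h1, h2, h3⟩ := RPoset.exists_step h
    have := x.numBlocks_le hd
    exact ⟨z, h1, h2, by omega⟩
  have hmono : ∀ n, StrictMono fun x : RPoset hkr hkd n => n - x.numBlocks := by
    intro n x y h
    have h1 : y.numBlocks < x.numBlocks := DowlingLattice.numBlocks_strictAnti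
      (lt_of_le_not_ge ((EvenDowling.toDowling_le (x := x.toNeBot) (y := y.toNeBot)).2 h.le)
        fun h' => h.not_ge ((EvenDowling.toDowling_le (x := y.toNeBot) (y := x.toNeBot)).1 h'))
    have := x.numBlocks_le hd
    simp only
    omega
  have hmin : ∀ n, ∀ x : RPoset hkr hkd n, IsMin x → n - x.numBlocks = 0 := fun n x hx => by
    rw [RPoset.numBlocks_of_isMin hd hx, Nat.sub_self]
  constructor
  · intro n hn
    obtain ⟨t, ht, -⟩ := RPoset.exists_top (hkr := hkr) (hkd := hkd) hd hn
    exact ⟨t, ht⟩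
  · intro n hn s hs
    obtain ⟨t, ht, ht'⟩ := RPoset.exists_top (hkr := hkr) (hkd := hkd) hd hn
    -- The top `c_n` has one block, hence rank `n - 1`, and maximal chains have `n` elements.
    rw [hs.encard_of_rank (hmono n) (hstep n) (hmin n) ht, ht']
    exact_mod_cast Nat.sub_add_cancel hn
  · intro n hn x
    have h1 := x.one_le_numBlocks hd hn
    have h2 := x.numBlocks_le hd
    refine ⟨n - x.numBlocks, by omega, Order.height_eq_of_rank (hmono n) (hstep n) (hmin n) x, ?_⟩
    rw [Nat.sub_sub_self h2]
    exact x.nonempty_Ici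
  · intro n hn x
    obtain ⟨a, h1, -, h2⟩ := x.exists_type hd
    exact ⟨a, h1, h2⟩
  · refine ⟨fun n => {x : RPoset hkr hkd n | IsMin x}.ncard, fun n _ => ?_⟩
    have : Finite (RPoset hkr hkd n) := Finite.of_injective RPoset.toNeBot fun x y h =>
      Subtype.ext (congrArg (fun z => z.1) h :)
    exact (Set.toFinite _).cast_ncard_eq.symm

theorem isExponentialDowlingStructure_SPoset [NeZero r] [NeZero k] {e : ℕ} (he : e < d) :
    IsExponentialDowlingStructure (CyclicGroup r) (fun n => SPoset r d e k n)
      (fun n => RPoset hkr hkd n) := by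
  have hstep : ∀ n, ∀ x y : SPoset r d e k n, x < y → ∃ z, x < z ∧ z ≤ y ∧
      n - (EvenDowling.toDowling z).numBlocks = n - (EvenDowling.toDowling x).numBlocks + 1 := by
    intro n x y h
    obtain ⟨z, h1, h2, h3⟩ := EvenDowling.exists_step hkr h
    have := SPoset.numBlocks_le hkr hkd he x
    exact ⟨z, h1, h2, by omega⟩
  have hmono : ∀ n, StrictMono fun x : SPoset r d e k n =>
      n - (EvenDowling.toDowling x).numBlocks := by
    intro n x y h
    have h1 : (EvenDowling.toDowling y).numBlocks < (EvenDowling.toDowling x).numBlocks :=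
      DowlingLattice.numBlocks_strictAnti (lt_of_le_not_ge (EvenDowling.toDowling_le.2 h.le)
        fun h' => h.not_ge (EvenDowling.toDowling_le.1 h'))
    have := SPoset.numBlocks_le hkr hkd he x
    simp only
    omega
  have hmin : ∀ n, ∀ x : SPoset r d e k n, IsMin x →
      n - (EvenDowling.toDowling x).numBlocks = 0 := fun n x hx => by
    rw [SPoset.numBlocks_of_isMin hkr hkd he hx, Nat.sub_self]
  constructor
  · exact isExponentialStructure_RPoset (by omega)
  · intro n
    obtain ⟨t, ht, -⟩ := SPoset.exists_top (d := d) hkr e n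
    exact ⟨t, ht⟩
  · intro n s hs
    obtain ⟨t, ht, ht'⟩ := SPoset.exists_top (d := d) hkr e n
    -- Here the top is the all-zero element: it has no nonzero block, hence rank `n`, and maximal
    -- chains have `n + 1` elements.
    rw [hs.encard_of_rank (hmono n) (hstep n) (hmin n) ht, ht', Nat.sub_zero]
  · intro n x
    have h2 := SPoset.numBlocks_le hkr hkd he x
    refine ⟨n - (EvenDowling.toDowling x).numBlocks, by omega,
      Order.height_eq_of_rank (hmono n) (hstep n) (hmin n) x, ?_⟩
    rw [Nat.sub_sub_self h2]
    exact EvenDowling.nonempty_Ici hkr x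
  · intro n x
    obtain ⟨b, a, h1, -, h2⟩ := SPoset.exists_type hkr hkd he x
    exact ⟨b, a, h1, h2⟩
  · exact ⟨fun n => {x : SPoset r d e k n | IsMin x}.ncard, fun n =>
      (Set.toFinite _).cast_ncard_eq.symm⟩

end Main

theorem mainTheorem7 (r d k e : ℕ) (hr : 0 < r) (hkr : k ∣ r) (hkd : k ∣ d) (he : e < d) :
    IsExponentialStructure (fun n => RPoset hkr hkd n) ∧
      IsExponentialDowlingStructure (CyclicGroup r) (fun n => SPoset r d e k n)
        (fun n => RPoset hkr hkd n) := by
  have : NeZero r := ⟨hr.ne'⟩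
  have : NeZero k := ⟨(Nat.pos_of_dvd_of_pos hkr hr).ne'⟩
  exact ⟨isExponentialStructure_RPoset (by omega), isExponentialDowlingStructure_SPoset he⟩
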